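/- Let $0<\alpha<1$ and $0<p<1$ be fixed, put $q=1-p$, and let $z_\alpha$ be the upper $\alpha$ quantile of the standard normal distribution, $\Phi(z_\alpha)=1-\alpha$. For $n\ge 1$ let $X\sim\mathrm{Bin}(n,p)$, and let $p_U=p_U(X)$ be the one-sided $1-\alpha$ Clopper--Pearson upper bound: for $X<n$, $p_U$ is the unique number in $[0,1]$ with $$\sum_{k=0}^{X}\binom nk p_U^{k}(1-p_U)^{n-k}=\alpha,$$ and $p_U=1$ for $X=n$. Then, as $n\to\infty$, $$E(p_U-p)=n^{-1/2}z_\alpha(pq)^{1/2}+(3n)^{-1}\Big(2\big(\tfrac12-p\big)z_\alpha^2+1+q\Big)+n^{-3/2}z_\alpha(pq)^{1/2}\Big(-\frac{53}{36}+\frac{\frac12-p}{q}+\frac{z_\alpha^2+\frac{13}{2}}{36pq}-\frac{13z_\alpha^2}{36}\Big)+O(n^{-2}),$$ where the constant in $O(n^{-2})$ may depend on $\alpha$ and $p$. -/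

import Mathlib

open ProbabilityTheory MeasureTheory

/-- The binomial lower tail `P_θ(X ≤ x) = ∑_{k=0}^{x} C(n,k) θ^k (1-θ)^(n-k)`. -/
noncomputable def binomialLowerTail (n x : ℕ) (θ : ℝ) : ℝ :=
  ∑ k ∈ Finset.range (x + 1), (n.choose k : ℝ) * θ ^ k * (1 - θ) ^ (n - k)

open Classical in
/-- The one-sided `1 - α` Clopper–Pearson upper bound computed from the observation `x` out of `n`:
the `θ ∈ [0,1]` with `P_θ(X ≤ x) = α`. For `0 < α < 1` and `x < n` there is exactly one such `θ`
(`existsUnique_binomialLowerTail_eq`). If there is none, as for `x = n`, where the tail is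
identically `1`, the bound is `1`. -/
noncomputable def clopperPearsonUpper (α : ℝ) (n x : ℕ) : ℝ :=
  if h : ∃ θ ∈ Set.Icc (0 : ℝ) 1, binomialLowerTail n x θ = α then h.choose else 1

/-- The upper `α` quantile `z_α` of the standard normal distribution, i.e. its `1 - α` quantile. -/
noncomputable def normalUpperQuantile (α : ℝ) : ℝ :=
  sInf {z : ℝ | 1 - α ≤ cdf (gaussianReal 0 1) z}

theorem hasDerivAt_binomialLowerTail {n x : ℕ} (hx : x < n) (θ : ℝ) :
    HasDerivAt (binomialLowerTail n x)
      (-((n.choose x : ℝ) * ((n - x : ℕ) : ℝ) * θ ^ x * (1 - θ) ^ (n - x - 1))) θ := by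
  have term : ∀ k : ℕ, HasDerivAt (fun t : ℝ => (n.choose k : ℝ) * t ^ k * (1 - t) ^ (n - k))
      ((n.choose k : ℝ) * ((k : ℝ) * θ ^ (k - 1)) * (1 - θ) ^ (n - k) +
        (n.choose k : ℝ) * θ ^ k * (((n - k : ℕ) : ℝ) * (1 - θ) ^ (n - k - 1) * (-1))) θ := by
    intro k
    have h1 : HasDerivAt (fun t : ℝ => 1 - t) (-1) θ := by
      simpa using (hasDerivAt_id θ).const_sub 1
    exact ((hasDerivAt_pow k θ).const_mul _).mul (h1.pow (n - k))
  induction x with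
  | zero =>
    have h := term 0
    have e : binomialLowerTail n 0 =
        fun t : ℝ => (n.choose 0 : ℝ) * t ^ 0 * (1 - t) ^ (n - 0) := by
      funext t; simp [binomialLowerTail]
    rw [e]
    refine h.congr_deriv ?_
    simp
  | succ x ih =>
    have h := (ih (by omega)).add (term (x + 1))
    have e : binomialLowerTail n (x + 1) = binomialLowerTail n x +
        fun t : ℝ => (n.choose (x + 1) : ℝ) * t ^ (x + 1) * (1 - t) ^ (n - (x + 1)) := by
      funext t; simp [binomialLowerTail, Finset.sum_range_succ]
    rw [e]
    refine h.congr_deriv ?_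
    have hc : (n.choose (x + 1) : ℝ) * ((x : ℝ) + 1) = (n.choose x : ℝ) * ((n - x : ℕ) : ℝ) := by
      exact_mod_cast Nat.choose_succ_right_eq n x
    have hs : n - x - 1 = n - (x + 1) := by omega
    rw [hs, ← hc]
    push_cast
    ring

/-- The Clopper–Pearson equation has exactly one solution in `[0,1]` when `x < n`. -/
theorem existsUnique_binomialLowerTail_eq {α : ℝ} (hα0 : 0 < α) (hα1 : α < 1) {n x : ℕ}
    (hx : x < n) : ∃! θ : ℝ, θ ∈ Set.Icc (0 : ℝ) 1 ∧ binomialLowerTail n x θ = α := by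
  have hcont : Continuous (binomialLowerTail n x) :=
    continuous_iff_continuousAt.2 fun θ => (hasDerivAt_binomialLowerTail hx θ).continuousAt
  have hanti : StrictAntiOn (binomialLowerTail n x) (Set.Icc 0 1) := by
    refine strictAntiOn_of_deriv_neg (convex_Icc 0 1) hcont.continuousOn ?_
    intro θ hθ
    rw [interior_Icc] at hθ
    rw [(hasDerivAt_binomialLowerTail hx θ).deriv]
    have h1 : (0 : ℝ) < n.choose x := by exact_mod_cast Nat.choose_pos hx.le
    have h2 : (0 : ℝ) < ((n - x : ℕ) : ℝ) := by exact_mod_cast Nat.sub_pos_of_lt hx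
    have h3 : (0 : ℝ) < θ := hθ.1
    have h4 : (0 : ℝ) < 1 - θ := sub_pos.2 hθ.2
    have : 0 < (n.choose x : ℝ) * ((n - x : ℕ) : ℝ) * θ ^ x * (1 - θ) ^ (n - x - 1) := by
      positivity
    linarith
  have h0 : binomialLowerTail n x 0 = 1 := by
    simp [binomialLowerTail, Finset.sum_range_succ']
  have h1 : binomialLowerTail n x 1 = 0 := by
    unfold binomialLowerTail
    refine Finset.sum_eq_zero fun k hk => ?_
    have hk' : n - k ≠ 0 := by
      have := Finset.mem_range.1 hk
      omega
    simp [hk']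
  obtain ⟨θ, hθ, hθα⟩ := intermediate_value_Icc' (zero_le_one' ℝ) hcont.continuousOn
    (show α ∈ Set.Icc (binomialLowerTail n x 1) (binomialLowerTail n x 0) by
      rw [h0, h1]; exact ⟨hα0.le, hα1.le⟩)
  exact ⟨θ, ⟨hθ, hθα⟩, fun y hy => hanti.injOn hy.1 hθ (hy.2.trans hθα.symm)⟩

theorem clopperPearsonUpper_spec {α : ℝ} (hα0 : 0 < α) (hα1 : α < 1) {n x : ℕ} (hx : x < n) :
    clopperPearsonUpper α n x ∈ Set.Icc (0 : ℝ) 1 ∧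
      binomialLowerTail n x (clopperPearsonUpper α n x) = α := by
  have h : ∃ θ ∈ Set.Icc (0 : ℝ) 1, binomialLowerTail n x θ = α :=
    (existsUnique_binomialLowerTail_eq hα0 hα1 hx).exists
  rw [clopperPearsonUpper, dif_pos h]
  exact h.choose_spec

theorem clopperPearsonUpper_self {α : ℝ} (hα1 : α < 1) (n : ℕ) :
    clopperPearsonUpper α n n = 1 := by
  have h : ¬ ∃ θ ∈ Set.Icc (0 : ℝ) 1, binomialLowerTail n n θ = α := by
    rintro ⟨θ, -, h⟩
    have h1 : binomialLowerTail n n θ = 1 := by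
      have := add_pow θ (1 - θ) n
      simp only [add_sub_cancel, one_pow] at this
      rw [this, binomialLowerTail]
      exact Finset.sum_congr rfl fun k _ => by ring
    linarith
  rw [clopperPearsonUpper, dif_neg h]

/-!
Let `e = n^(-1/2)`, let `y = x / n` be the observed frequency, and let
`T w = betaQuantileApprox y e w` be the Cornish–Fisher expansion of the `Beta(x + 1, n - x)`
quantile at the normal quantile `w`. Its coefficients are chosen so that the binomial lower tail
at `T w` has derivative `-c φ(w) exp (L w)` with `L 0 = 0` and `L' = O(e³)` up to polynomial factors
in `w`. For `y` bounded away from `0` and `1`, integrating over `|w| ≤ log n`, with exponential tail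
bounds at both ends to find `c = 1 + O(e³)`, shows that the tail at `T w` is `1 - Φ(w) + O(e³)`.
Inverting it gains the factor `T' = O(e)`, so the Clopper–Pearson bound is `T z + O(e⁴)`.

Expanding `T z` to second order in `d = y - p` leaves an error `O(e⁴ + d⁴)`; away from `d = 0`
everything is `O(1) = O(d⁴)`. Taking means, `E d = 0`, `E d² = e² p (1 - p)` and `E d⁴ ≤ e⁴` give
the claim.
-/

open Filter Topology

/-! ### Polynomial growth -/

/-- `f` grows at most polynomially in the parameter `r` over the index set `S`. -/
@[fun_prop]
def HasPolyGrowthOn {ι : Type*} (f : ι → ℝ) (r : ι → ℝ) (S : Set ι) : Prop :=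
  ∃ C : ℝ, ∃ k : ℕ, ∀ a ∈ S, |f a| ≤ C * (1 + |r a|) ^ k

namespace HasPolyGrowthOn

variable {ι : Type*} {f g r : ι → ℝ} {S : Set ι}

theorem of_abs_le {C : ℝ} (h : ∀ a ∈ S, |f a| ≤ C) : HasPolyGrowthOn f r S :=
  ⟨C, 0, fun a ha => by simpa using h a ha⟩

@[fun_prop]
theorem const (c : ℝ) : HasPolyGrowthOn (fun _ => c) r S :=
  of_abs_le fun _ _ => le_rfl

theorem self : HasPolyGrowthOn r r S :=
  ⟨1, 1, fun a _ => by linarith [pow_one (1 + |r a|)]⟩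

theorem exists_le_nonneg (hf : HasPolyGrowthOn f r S) :
    ∃ C : ℝ, 0 ≤ C ∧ ∃ k : ℕ, ∀ a ∈ S, |f a| ≤ C * (1 + |r a|) ^ k := by
  obtain ⟨C, k, h⟩ := hf
  refine ⟨|C|, abs_nonneg C, k, fun a ha => (h a ha).trans ?_⟩
  gcongr
  exact le_abs_self C

@[fun_prop]
theorem add (hf : HasPolyGrowthOn f r S) (hg : HasPolyGrowthOn g r S) :
    HasPolyGrowthOn (fun a => f a + g a) r S := by
  obtain ⟨C, hC, k, hf⟩ := hf.exists_le_nonneg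
  obtain ⟨D, hD, l, hg⟩ := hg.exists_le_nonneg
  refine ⟨C + D, max k l, fun a ha => (abs_add_le _ _).trans ?_⟩
  have hr : 1 ≤ 1 + |r a| := le_add_of_nonneg_right (abs_nonneg _)
  calc |f a| + |g a| ≤ C * (1 + |r a|) ^ k + D * (1 + |r a|) ^ l := add_le_add (hf a ha) (hg a ha)
    _ ≤ C * (1 + |r a|) ^ max k l + D * (1 + |r a|) ^ max k l := by
      gcongr <;> first | exact hr | exact le_max_left k l | exact le_max_right k l
    _ = (C + D) * (1 + |r a|) ^ max k l := (add_mul ..).symm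

@[fun_prop]
theorem mul (hf : HasPolyGrowthOn f r S) (hg : HasPolyGrowthOn g r S) :
    HasPolyGrowthOn (fun a => f a * g a) r S := by
  obtain ⟨C, hC, k, hf⟩ := hf.exists_le_nonneg
  obtain ⟨D, l, hg⟩ := hg
  refine ⟨C * D, k + l, fun a ha => ?_⟩
  calc |f a * g a| = |f a| * |g a| := abs_mul _ _
    _ ≤ (C * (1 + |r a|) ^ k) * (D * (1 + |r a|) ^ l) := by
      gcongr
      exacts [hf a ha, hg a ha]
    _ = C * D * (1 + |r a|) ^ (k + l) := by ring

@[fun_prop]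
theorem neg (hf : HasPolyGrowthOn f r S) : HasPolyGrowthOn (fun a => -f a) r S := by
  simpa only [HasPolyGrowthOn, abs_neg] using hf

@[fun_prop]
theorem sub (hf : HasPolyGrowthOn f r S) (hg : HasPolyGrowthOn g r S) :
    HasPolyGrowthOn (fun a => f a - g a) r S := by
  simpa only [sub_eq_add_neg] using hf.add hg.neg

@[fun_prop]
theorem pow (hf : HasPolyGrowthOn f r S) (n : ℕ) : HasPolyGrowthOn (fun a => f a ^ n) r S := by
  induction n with
  | zero => simpa only [pow_zero] using const 1
  | succ n ih => simpa only [pow_succ] using ih.mul hf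

@[fun_prop]
theorem div_const (hf : HasPolyGrowthOn f r S) (c : ℝ) :
    HasPolyGrowthOn (fun a => f a / c) r S := by
  simpa only [div_eq_mul_inv] using hf.mul (const c⁻¹)

theorem inv (hf : ∃ c > 0, ∀ a ∈ S, c ≤ |f a|) : HasPolyGrowthOn (fun a => (f a)⁻¹) r S := by
  obtain ⟨c, hc, hf⟩ := hf
  refine of_abs_le (C := c⁻¹) fun a ha => ?_
  rw [abs_inv]
  exact inv_anti₀ hc (hf a ha)

end HasPolyGrowthOn

/-! ### The Cornish–Fisher expansion of the beta quantile -/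

/-- The standard deviation `√(y (1 - y))` of a Bernoulli variable with success probability `y`. -/
noncomputable def bernoulliStd (y : ℝ) : ℝ := √(y * (1 - y))

theorem bernoulliStd_sq {y : ℝ} (hy : y ∈ Set.Icc 0 1) : bernoulliStd y ^ 2 = y * (1 - y) :=
  Real.sq_sqrt (mul_nonneg hy.1 (sub_nonneg.2 hy.2))

theorem bernoulliStd_pos {y : ℝ} (hy : y ∈ Set.Ioo 0 1) : 0 < bernoulliStd y :=
  Real.sqrt_pos.2 (mul_pos hy.1 (sub_pos.2 hy.2))

theorem bernoulliStd_le_one (y : ℝ) : bernoulliStd y ≤ 1 :=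
  Real.sqrt_le_one.2 (by nlinarith [sq_nonneg (y - 1 / 2)])

theorem le_bernoulliStd {η y : ℝ} (hη : 0 < η) (hy : y ∈ Set.Icc η (1 - η)) :
    η ≤ bernoulliStd y :=
  Real.le_sqrt_of_sq_le (by nlinarith [hy.1, hy.2])

/-- The coefficient of `n⁻¹` in the expansion of the beta quantile at the normal quantile `w`. -/
noncomputable def quantileCoeffTwo (y w : ℝ) : ℝ := ((1 - 2 * y) * w ^ 2 + 2 - y) / 3

/-- The coefficient of `n^(-3/2)` in the expansion of the beta quantile at the normal quantile
`w`. -/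
noncomputable def quantileCoeffThree (y w : ℝ) : ℝ :=
  (bernoulliStd y)⁻¹ * ((1 - 13 * y + 13 * y ^ 2) * w ^ 3 + (11 - 35 * y + 17 * y ^ 2) * w) / 36

/-- The derivative of `quantileCoeffTwo` in `w`. -/
noncomputable def quantileCoeffTwoDeriv (y w : ℝ) : ℝ := 2 * (1 - 2 * y) * w / 3

/-- The derivative of `quantileCoeffThree` in `w`. -/
noncomputable def quantileCoeffThreeDeriv (y w : ℝ) : ℝ :=
  (bernoulliStd y)⁻¹ * (3 * (1 - 13 * y + 13 * y ^ 2) * w ^ 2 + (11 - 35 * y + 17 * y ^ 2)) / 36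

/-- The rescaled deviation of the approximate beta quantile from `y`, where `e` stands for
`n^(-1/2)`. -/
noncomputable def quantileDev (y e w : ℝ) : ℝ :=
  bernoulliStd y * w + e * quantileCoeffTwo y w + e ^ 2 * quantileCoeffThree y w

/-- The derivative of `quantileDev` in `w`. -/
noncomputable def quantileDevDeriv (y e w : ℝ) : ℝ :=
  bernoulliStd y + e * quantileCoeffTwoDeriv y w + e ^ 2 * quantileCoeffThreeDeriv y w

/-- The second derivative of `quantileDev` in `w`, divided by `e`. -/
noncomputable def quantileDevSecond (y e w : ℝ) : ℝ :=
  2 * (1 - 2 * y) / 3 + e * ((bernoulliStd y)⁻¹ * (1 - 13 * y + 13 * y ^ 2) * w / 6)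

/-- The approximate beta quantile at the normal quantile `w`, where `y` is the observed frequency
and `e` stands for `n^(-1/2)`. -/
noncomputable def betaQuantileApprox (y e w : ℝ) : ℝ := y + e * quantileDev y e w

theorem hasDerivAt_quantileCoeffTwo (y w : ℝ) :
    HasDerivAt (quantileCoeffTwo y) (quantileCoeffTwoDeriv y w) w := by
  refine (((((hasDerivAt_pow 2 w).const_mul (1 - 2 * y)).add_const 2).sub_const y).div_const
    3).congr_deriv ?_
  simp only [quantileCoeffTwoDeriv]
  push_cast
  ring

theorem hasDerivAt_quantileCoeffThree (y w : ℝ) :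
    HasDerivAt (quantileCoeffThree y) (quantileCoeffThreeDeriv y w) w := by
  refine (((((hasDerivAt_pow 3 w).const_mul (1 - 13 * y + 13 * y ^ 2)).add
    ((hasDerivAt_id w).const_mul (11 - 35 * y + 17 * y ^ 2))).const_mul
      (bernoulliStd y)⁻¹).div_const 36).congr_deriv ?_
  simp only [quantileCoeffThreeDeriv]
  push_cast
  ring

theorem hasDerivAt_quantileDev (y e w : ℝ) :
    HasDerivAt (quantileDev y e) (quantileDevDeriv y e w) w := by
  refine ((((hasDerivAt_id w).const_mul (bernoulliStd y)).add
    ((hasDerivAt_quantileCoeffTwo y w).const_mul e)).add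
      ((hasDerivAt_quantileCoeffThree y w).const_mul (e ^ 2))).congr_deriv ?_
  simp only [quantileDevDeriv, mul_one]

theorem hasDerivAt_quantileDevDeriv (y e w : ℝ) :
    HasDerivAt (quantileDevDeriv y e) (e * quantileDevSecond y e w) w := by
  refine ((((((hasDerivAt_id w).const_mul (2 * (1 - 2 * y))).div_const 3).const_mul e).const_add
    (bernoulliStd y)).add ((((((hasDerivAt_pow 2 w).const_mul
      (3 * (1 - 13 * y + 13 * y ^ 2))).add_const (11 - 35 * y + 17 * y ^ 2)).const_mul
        (bernoulliStd y)⁻¹).div_const 36).const_mul (e ^ 2))).congr_deriv ?_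
  simp only [quantileDevSecond]
  push_cast
  ring

theorem hasDerivAt_betaQuantileApprox (y e w : ℝ) :
    HasDerivAt (betaQuantileApprox y e) (e * quantileDevDeriv y e w) w :=
  ((hasDerivAt_quantileDev y e w).const_mul e).const_add y

theorem quantileCoeffTwo_cancellation (y w : ℝ) :
    2 * (1 - 2 * y) / 3 + (1 - 2 * y) * w ^ 2 - quantileCoeffTwo y w
      - w * quantileCoeffTwoDeriv y w + y = 0 := by
  simp only [quantileCoeffTwo, quantileCoeffTwoDeriv]
  ring

theorem quantileCoeffThree_cancellation {y : ℝ} (hy : y ∈ Set.Ioo 0 1) (w : ℝ) :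
    let s := bernoulliStd y
    let a := quantileCoeffTwoDeriv y w
    s * (1 - 13 * y + 13 * y ^ 2) * w / 6 + 2 * (1 - 2 * y) / 3 * ((1 - 2 * y) * s * w)
      + s * ((1 - 2 * y) * w * quantileCoeffTwo y w - s * quantileCoeffThree y w
        - s * w * quantileCoeffThreeDeriv y w - s ^ 2 * w ^ 3 - a * quantileCoeffTwo y w)
      + a * (s * ((1 - 2 * y) * w ^ 2 - quantileCoeffTwo y w - w * a))
      + 2 * s * a * y + s ^ 3 * w = 0 := by
  intro s a
  have hs : s ≠ 0 := (bernoulliStd_pos hy).ne'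
  have hsq : s ^ 2 = y * (1 - y) := bernoulliStd_sq (Set.Ioo_subset_Icc_self hy)
  simp only [a, quantileCoeffTwo, quantileCoeffTwoDeriv, quantileCoeffThree,
    quantileCoeffThreeDeriv]
  change _ + s * (_ - s * (s⁻¹ * _ / 36) - s * w * (s⁻¹ * _ / 36) - _ - _) + _ + _ + _ = _
  field_simp
  linear_combination (w - w ^ 3) * s * 1944 * hsq

/-- The coefficient of `e ^ 3` left over in the numerator of the logarithmic derivative of the
transformed beta density relative to the Gaussian one, after the lower orders have cancelled. The
terms are grouped by the factors `B`, `s + e * q` and `(s + e * q) ^ 2` of that numerator. -/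
noncomputable def quantileResidual (y e w : ℝ) : ℝ :=
  let s := bernoulliStd y
  let Q := quantileCoeffTwo y w + e * quantileCoeffThree y w
  let q := quantileCoeffTwoDeriv y w + e * quantileCoeffThreeDeriv y w
  let A := quantileDev y e w
  let B₁ := s⁻¹ * (1 - 13 * y + 13 * y ^ 2) * w / 6
  let G₀ := s * ((1 - 2 * y) * w ^ 2 - quantileCoeffTwo y w - w * quantileCoeffTwoDeriv y w)
  let G₁ := (1 - 2 * y) * w * quantileCoeffTwo y w - s * quantileCoeffThree y w
    - s * w * quantileCoeffThreeDeriv y w - s ^ 2 * w ^ 3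
    - quantileCoeffTwoDeriv y w * quantileCoeffTwo y w
  let G₂ := (1 - 2 * y) * w * quantileCoeffThree y w - w * Q * (A + s * w)
    - (quantileCoeffThreeDeriv y w * Q + quantileCoeffTwoDeriv y w * quantileCoeffThree y w)
  (quantileDevSecond y e w * ((1 - 2 * y) * Q - A ^ 2) + B₁ * ((1 - 2 * y) * s * w))
    + (s * G₂ + q * (G₁ + e * G₂) + quantileCoeffThreeDeriv y w * G₀)
    + (quantileDevDeriv y e w ^ 2 * Q + 2 * s ^ 2 * quantileCoeffTwoDeriv y w * w
      + (2 * s * quantileCoeffThreeDeriv y w + q ^ 2) * (y + e * s * w))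

theorem quantileDev_ode {y : ℝ} (hy : y ∈ Set.Ioo 0 1) (e w : ℝ) :
    (e * quantileDevSecond y e w + w * quantileDevDeriv y e w) *
        (betaQuantileApprox y e w * (1 - betaQuantileApprox y e w)) +
      quantileDevDeriv y e w ^ 2 *
        (-quantileDev y e w + e * y + e ^ 2 * quantileDev y e w) =
      e ^ 3 * quantileResidual y e w := by
  have hs : bernoulliStd y * (bernoulliStd y)⁻¹ = 1 := mul_inv_cancel₀ (bernoulliStd_pos hy).ne'
  have hsq : bernoulliStd y ^ 2 = y * (1 - y) := bernoulliStd_sq (Set.Ioo_subset_Icc_self hy)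
  have h₂ := quantileCoeffTwo_cancellation y w
  have h₃ := quantileCoeffThree_cancellation hy w
  simp only [quantileResidual, betaQuantileApprox, quantileDevSecond, quantileDevDeriv,
    quantileDev] at h₃ ⊢
  generalize bernoulliStd y = s at *
  generalize s⁻¹ = r at *
  generalize quantileCoeffTwo y w = c₂ at *
  generalize quantileCoeffThree y w = c₃ at *
  generalize quantileCoeffTwoDeriv y w = a₂ at *
  generalize quantileCoeffThreeDeriv y w = a₃ at *
  linear_combination e * s ^ 2 * h₂ + e ^ 2 * h₃ -
    (e * (2 * (1 - 2 * y) / 3 + e * (r * (1 - 13 * y + 13 * y ^ 2) * w / 6))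
      + w * (s + e * a₂ + e ^ 2 * a₃)) * hsq + e ^ 2 * s * (1 - 13 * y + 13 * y ^ 2) * w / 6 * hs

/-- The triples `(y, e, w)` with the frequency `y` at distance at least `η` from `0` and `1` and
`0 ≤ e ≤ 1`, over which the expansion is uniform. -/
def quantileDomain (η : ℝ) : Set (ℝ × ℝ × ℝ) :=
  {a | a.1 ∈ Set.Icc η (1 - η) ∧ a.2.1 ∈ Set.Icc 0 1}

section Growth

variable {η : ℝ}

@[fun_prop]
theorem hasPolyGrowthOn_frequency (hη : 0 < η) :
    HasPolyGrowthOn (fun a : ℝ × ℝ × ℝ => a.1) (fun a => a.2.2) (quantileDomain η) :=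
  .of_abs_le (C := 1) fun _ ha => abs_le.2 ⟨by linarith [ha.1.1], by linarith [ha.1.2]⟩

@[fun_prop]
theorem hasPolyGrowthOn_scale :
    HasPolyGrowthOn (fun a : ℝ × ℝ × ℝ => a.2.1) (fun a => a.2.2) (quantileDomain η) :=
  .of_abs_le (C := 1) fun _ ha => abs_le.2 ⟨by linarith [ha.2.1], ha.2.2⟩

@[fun_prop]
theorem hasPolyGrowthOn_normalQuantile :
    HasPolyGrowthOn (fun a : ℝ × ℝ × ℝ => a.2.2) (fun a => a.2.2) (quantileDomain η) :=
  .self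

@[fun_prop]
theorem hasPolyGrowthOn_bernoulliStd :
    HasPolyGrowthOn (fun a : ℝ × ℝ × ℝ => bernoulliStd a.1) (fun a => a.2.2) (quantileDomain η) :=
  .of_abs_le (C := 1) fun _ _ => by
    rw [bernoulliStd, abs_of_nonneg (Real.sqrt_nonneg _)]
    exact bernoulliStd_le_one _

@[fun_prop]
theorem hasPolyGrowthOn_inv_bernoulliStd (hη : 0 < η) :
    HasPolyGrowthOn (fun a : ℝ × ℝ × ℝ => (bernoulliStd a.1)⁻¹) (fun a => a.2.2)
      (quantileDomain η) :=
  .inv ⟨η, hη, fun _ ha => (le_bernoulliStd hη ha.1).trans (le_abs_self _)⟩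

theorem hasPolyGrowthOn_quantileDev (hη : 0 < η) :
    HasPolyGrowthOn (fun a : ℝ × ℝ × ℝ => quantileDev a.1 a.2.1 a.2.2) (fun a => a.2.2)
      (quantileDomain η) := by
  simp only [quantileDev, quantileCoeffTwo, quantileCoeffThree]
  fun_prop (disch := assumption)

theorem hasPolyGrowthOn_quantileCorrection (hη : 0 < η) :
    HasPolyGrowthOn
      (fun a : ℝ × ℝ × ℝ => quantileCoeffTwo a.1 a.2.2 + a.2.1 * quantileCoeffThree a.1 a.2.2)
      (fun a => a.2.2) (quantileDomain η) := by
  simp only [quantileCoeffTwo, quantileCoeffThree]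
  fun_prop (disch := assumption)

theorem hasPolyGrowthOn_quantileCorrectionDeriv (hη : 0 < η) :
    HasPolyGrowthOn (fun a : ℝ × ℝ × ℝ =>
        quantileCoeffTwoDeriv a.1 a.2.2 + a.2.1 * quantileCoeffThreeDeriv a.1 a.2.2)
      (fun a => a.2.2) (quantileDomain η) := by
  simp only [quantileCoeffTwoDeriv, quantileCoeffThreeDeriv]
  fun_prop (disch := assumption)

theorem hasPolyGrowthOn_quantileResidual (hη : 0 < η) :
    HasPolyGrowthOn (fun a : ℝ × ℝ × ℝ => quantileResidual a.1 a.2.1 a.2.2) (fun a => a.2.2)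
      (quantileDomain η) := by
  simp only [quantileResidual, quantileDev, quantileDevDeriv, quantileDevSecond,
    quantileCoeffTwo, quantileCoeffThree, quantileCoeffTwoDeriv, quantileCoeffThreeDeriv]
  fun_prop (disch := assumption)

end Growth

/-! ### Uniform estimates on the range `|w| ≤ log n` -/

/-- The parameter `n^(-1/2)` in powers of which the Clopper–Pearson bound is expanded. -/
noncomputable def invSqrt (n : ℕ) : ℝ := (√n)⁻¹

theorem invSqrt_pos {n : ℕ} (hn : 0 < n) : 0 < invSqrt n :=
  inv_pos.2 (Real.sqrt_pos.2 (Nat.cast_pos.2 hn))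

theorem invSqrt_nonneg (n : ℕ) : 0 ≤ invSqrt n :=
  inv_nonneg.2 (Real.sqrt_nonneg _)

theorem invSqrt_sq (n : ℕ) : invSqrt n ^ 2 = (n : ℝ)⁻¹ := by
  rw [invSqrt, inv_pow, Real.sq_sqrt n.cast_nonneg]

theorem natCast_mul_invSqrt_sq {n : ℕ} (hn : n ≠ 0) : n * invSqrt n ^ 2 = 1 := by
  rw [invSqrt_sq, mul_inv_cancel₀ (Nat.cast_ne_zero.2 hn)]

theorem invSqrt_le_one (n : ℕ) : invSqrt n ≤ 1 := by
  rw [← sq_le_one_iff₀ (invSqrt_nonneg n), invSqrt_sq]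
  exact Nat.cast_inv_le_one n

theorem natCast_rpow_neg_half (n : ℕ) : (n : ℝ) ^ (-(1 / 2) : ℝ) = invSqrt n := by
  rw [Real.rpow_neg n.cast_nonneg, ← Real.sqrt_eq_rpow, invSqrt]

theorem natCast_rpow_neg_three_halves (n : ℕ) : (n : ℝ) ^ (-(3 / 2) : ℝ) = invSqrt n ^ 3 := by
  rw [show (-(3 / 2) : ℝ) = -(1 / 2) * (3 : ℕ) by norm_num, Real.rpow_mul_natCast n.cast_nonneg,
    natCast_rpow_neg_half]

theorem natCast_rpow_neg_two (n : ℕ) : (n : ℝ) ^ (-2 : ℝ) = invSqrt n ^ 4 := by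
  rw [show (-2 : ℝ) = -(1 / 2) * (4 : ℕ) by norm_num, Real.rpow_mul_natCast n.cast_nonneg,
    natCast_rpow_neg_half]

theorem tendsto_invSqrt_mul_one_add_log_pow (C : ℝ) (k : ℕ) :
    Tendsto (fun n : ℕ => invSqrt n * (C * (1 + Real.log n) ^ k)) atTop (𝓝 0) := by
  have h₁ : (fun n : ℕ => C * (1 + Real.log n) ^ k) =O[atTop] fun n : ℕ => Real.log n ^ k := by
    refine (Asymptotics.IsBigO.pow ?_ k).const_mul_left C
    refine Asymptotics.IsBigO.add (Asymptotics.isLittleO_const_left.2 (.inr ?_)).isBigO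
      (Asymptotics.isBigO_refl _ _)
    exact tendsto_norm_atTop_atTop.comp (Real.tendsto_log_atTop.comp tendsto_natCast_atTop_atTop)
  have h₂ : (fun n : ℕ => Real.log n ^ k) =o[atTop] fun n : ℕ => √n := by
    have := (isLittleO_log_rpow_rpow_atTop k (show (0 : ℝ) < 1 / 2 by norm_num)).comp_tendsto
      tendsto_natCast_atTop_atTop
    simpa only [Function.comp_def, Real.rpow_natCast, ← Real.sqrt_eq_rpow] using this
  simpa only [invSqrt, div_eq_inv_mul] using (h₁.trans_isLittleO h₂).tendsto_div_nhds_zero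

theorem eventually_abs_invSqrt_mul_le {η ε : ℝ} (hε : 0 < ε) {f : ℝ × ℝ × ℝ → ℝ}
    (hf : HasPolyGrowthOn f (fun a => a.2.2) (quantileDomain η)) :
    ∀ᶠ n : ℕ in atTop, ∀ y ∈ Set.Icc η (1 - η), ∀ w, |w| ≤ Real.log n →
      |invSqrt n * f (y, invSqrt n, w)| ≤ ε := by
  obtain ⟨C, hC, k, h⟩ := hf.exists_le_nonneg
  filter_upwards [(tendsto_invSqrt_mul_one_add_log_pow C k).eventually_lt_const hε] with n hn y hy
    w hw
  have he := invSqrt_nonneg n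
  calc |invSqrt n * f (y, invSqrt n, w)| = invSqrt n * |f (y, invSqrt n, w)| := by
        rw [abs_mul, abs_of_nonneg he]
    _ ≤ invSqrt n * (C * (1 + |w|) ^ k) := by
        gcongr
        exact h (y, invSqrt n, w) ⟨hy, he, invSqrt_le_one n⟩
    _ ≤ invSqrt n * (C * (1 + Real.log n) ^ k) := by gcongr
    _ ≤ ε := hn.le

/-- At the normal quantile `w`, the approximate beta quantile stays away from `0` and `1` and its
leading term `e * bernoulliStd y * w` dominates. -/
structure IsQuantileRegular (η y e w : ℝ) : Prop where
  le_approx : η / 2 ≤ betaQuantileApprox y e w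
  approx_le : betaQuantileApprox y e w ≤ 1 - η / 2
  le_deriv : η / 2 ≤ quantileDevDeriv y e w
  deriv_le : quantileDevDeriv y e w ≤ 2
  abs_dev_sub_le : |quantileDev y e w - bernoulliStd y * w| ≤ η / 4

theorem eventually_isQuantileRegular {η : ℝ} (hη : 0 < η) :
    ∀ᶠ n : ℕ in atTop, ∀ y ∈ Set.Icc η (1 - η), ∀ w, |w| ≤ Real.log n →
      IsQuantileRegular η y (invSqrt n) w := by
  filter_upwards [eventually_abs_invSqrt_mul_le (half_pos hη) (hasPolyGrowthOn_quantileDev hη),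
    eventually_abs_invSqrt_mul_le (show 0 < η / 4 by linarith)
      (hasPolyGrowthOn_quantileCorrection hη),
    eventually_abs_invSqrt_mul_le (half_pos hη) (hasPolyGrowthOn_quantileCorrectionDeriv hη)]
    with n hdev hcorr hderiv y hy w hw
  have hs := le_bernoulliStd hη hy
  have hs₁ := bernoulliStd_le_one y
  have hη₁ : η ≤ 1 - η := hy.1.trans hy.2
  have hA := abs_le.1 (hdev y hy w hw)
  have hD : quantileDevDeriv y (invSqrt n) w = bernoulliStd y + invSqrt n *
      (quantileCoeffTwoDeriv y w + invSqrt n * quantileCoeffThreeDeriv y w) := by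
    rw [quantileDevDeriv]; ring
  have hq := abs_le.1 (hderiv y hy w hw)
  refine ⟨?_, ?_, ?_, ?_, (congrArg abs ?_).trans_le (hcorr y hy w hw)⟩
  · rw [betaQuantileApprox]; linarith [hy.1]
  · rw [betaQuantileApprox]; linarith [hy.2]
  · rw [hD]; linarith
  · rw [hD]; linarith
  · rw [quantileDev]; ring

namespace IsQuantileRegular

variable {η y e w : ℝ}

theorem approx_pos (h : IsQuantileRegular η y e w) (hη : 0 < η) : 0 < betaQuantileApprox y e w := by
  linarith [h.le_approx]

theorem one_sub_approx_pos (h : IsQuantileRegular η y e w) (hη : 0 < η) :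
    0 < 1 - betaQuantileApprox y e w := by
  linarith [h.approx_le]

theorem deriv_pos (h : IsQuantileRegular η y e w) (hη : 0 < η) : 0 < quantileDevDeriv y e w := by
  linarith [h.le_deriv]

theorem approx_mem_Icc (h : IsQuantileRegular η y e w) (hη : 0 < η) :
    betaQuantileApprox y e w ∈ Set.Icc 0 1 :=
  ⟨(h.approx_pos hη).le, (sub_pos.1 (h.one_sub_approx_pos hη)).le⟩

theorem pow_three_le_deriv_mul_variance (h : IsQuantileRegular η y e w) (hη : 0 < η) :
    (η / 2) ^ 3 ≤ quantileDevDeriv y e w *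
      (betaQuantileApprox y e w * (1 - betaQuantileApprox y e w)) := by
  have hT := h.approx_pos hη
  have hD := h.deriv_pos hη
  rw [pow_three]
  gcongr
  exacts [h.le_deriv, h.le_approx, by linarith [h.approx_le]]

end IsQuantileRegular

/-- Up to an additive constant, the logarithm of the density of `betaQuantileApprox (x / n) e`
pulled back from the `Beta(x + 1, n - x)` law, relative to the standard normal density at `w`. -/
noncomputable def logDensityRatio (n x : ℕ) (w : ℝ) : ℝ :=
  x * Real.log (betaQuantileApprox (x / n) (invSqrt n) w) +
    (n - x - 1 : ℕ) * Real.log (1 - betaQuantileApprox (x / n) (invSqrt n) w) +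
      Real.log (quantileDevDeriv (x / n) (invSqrt n) w) + w ^ 2 / 2

section LogDensityRatio

variable {n x : ℕ} {η w : ℝ}

theorem lt_of_div_le_one_sub (hη : 0 < η) (hn : 0 < n) (hx : (x / n : ℝ) ≤ 1 - η) : x < n := by
  have h := (div_lt_one (Nat.cast_pos.2 hn)).1 (hx.trans_lt (sub_lt_self 1 hη))
  exact_mod_cast h

theorem hasDerivAt_logDensityRatio (hη : 0 < η) (hn : 0 < n)
    (hx : (x / n : ℝ) ∈ Set.Icc η (1 - η)) (h : IsQuantileRegular η (x / n) (invSqrt n) w) :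
    HasDerivAt (logDensityRatio n x)
      (invSqrt n ^ 3 * quantileResidual (x / n) (invSqrt n) w /
        (quantileDevDeriv (x / n) (invSqrt n) w * (betaQuantileApprox (x / n) (invSqrt n) w *
          (1 - betaQuantileApprox (x / n) (invSqrt n) w)))) w := by
  have hT₀ := (h.approx_pos hη).ne'
  have hT₁ := (h.one_sub_approx_pos hη).ne'
  have hD := (h.deriv_pos hη).ne'
  have hT := hasDerivAt_betaQuantileApprox (x / n) (invSqrt n) w
  refine ((((hT.log hT₀).const_mul _).add (((hT.const_sub 1).log hT₁).const_mul _)).add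
    ((hasDerivAt_quantileDevDeriv _ _ w).log hD)).add
      ((hasDerivAt_pow 2 w).div_const 2) |>.congr_deriv ?_
  rw [← quantileDev_ode ⟨hη.trans_le hx.1, hx.2.trans_lt (sub_lt_self 1 hη)⟩]
  have hM : ((n - x - 1 : ℕ) : ℝ) = n - x - 1 := by
    rw [Nat.sub_sub, Nat.cast_sub (lt_of_div_le_one_sub hη hn hx.2)]
    push_cast
    ring
  have hscore : invSqrt n * (x * (1 - betaQuantileApprox (x / n) (invSqrt n) w) -
      (n - x - 1) * betaQuantileApprox (x / n) (invSqrt n) w) =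
      -quantileDev (x / n) (invSqrt n) w + invSqrt n * (x / n) +
        invSqrt n ^ 2 * quantileDev (x / n) (invSqrt n) w := by
    have hxn : (n : ℝ) * (x / n) = x := mul_div_cancel₀ _ (Nat.cast_ne_zero.2 hn.ne')
    rw [betaQuantileApprox]
    linear_combination -quantileDev (x / n) (invSqrt n) w * natCast_mul_invSqrt_sq hn.ne' -
      invSqrt n * hxn
  rw [← hscore, hM]
  field_simp
  push_cast
  ring

theorem exp_logDensityRatio (hη : 0 < η) (h : IsQuantileRegular η (x / n) (invSqrt n) w) :
    Real.exp (logDensityRatio n x w) = betaQuantileApprox (x / n) (invSqrt n) w ^ x *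
      (1 - betaQuantileApprox (x / n) (invSqrt n) w) ^ (n - x - 1) *
        quantileDevDeriv (x / n) (invSqrt n) w * Real.exp (w ^ 2 / 2) := by
  rw [logDensityRatio, Real.exp_add, Real.exp_add, Real.exp_add, Real.exp_nat_mul,
    Real.exp_nat_mul, Real.exp_log (h.approx_pos hη), Real.exp_log (h.one_sub_approx_pos hη),
    Real.exp_log (h.deriv_pos hη)]

end LogDensityRatio

theorem eventually_abs_logDensityRatio_sub_le {η : ℝ} (hη : 0 < η) :
    ∃ C : ℝ, 0 ≤ C ∧ ∃ k : ℕ, ∀ᶠ n : ℕ in atTop, ∀ x : ℕ, (x / n : ℝ) ∈ Set.Icc η (1 - η) →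
      ∀ w, |w| ≤ Real.log n →
        |logDensityRatio n x w - logDensityRatio n x 0| ≤
          invSqrt n ^ 3 * (C * (1 + |w|) ^ k) := by
  obtain ⟨C, hC, k, hR⟩ := (hasPolyGrowthOn_quantileResidual hη).exists_le_nonneg
  refine ⟨C / (η / 2) ^ 3, by positivity, k + 1, ?_⟩
  filter_upwards [eventually_isQuantileRegular hη, eventually_gt_atTop 0] with n hreg hn x hx w hw
  have he := invSqrt_nonneg n
  have hreg' : ∀ v, |v| ≤ |w| → IsQuantileRegular η (x / n) (invSqrt n) v :=
    fun v hv => hreg _ hx v (hv.trans hw)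
  have hderiv : ∀ v, |v| ≤ |w| → ‖invSqrt n ^ 3 * quantileResidual (x / n) (invSqrt n) v /
      (quantileDevDeriv (x / n) (invSqrt n) v * (betaQuantileApprox (x / n) (invSqrt n) v *
        (1 - betaQuantileApprox (x / n) (invSqrt n) v)))‖ ≤
      invSqrt n ^ 3 * (C * (1 + |w|) ^ k) / (η / 2) ^ 3 := by
    intro v hv
    have hden := (hreg' v hv).pow_three_le_deriv_mul_variance hη
    have hden₀ : 0 < (η / 2) ^ 3 := by positivity
    rw [Real.norm_eq_abs, abs_div, abs_of_pos (hden₀.trans_le hden), abs_mul,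
      abs_of_nonneg (pow_nonneg he 3)]
    gcongr
    exact (hR (x / n, invSqrt n, v) ⟨hx, he, invSqrt_le_one n⟩).trans (by gcongr)
  have hle := (convex_Icc (-|w|) |w|).norm_image_sub_le_of_norm_hasDerivWithin_le (x := 0) (y := w)
    (fun v hv => (hasDerivAt_logDensityRatio hη hn hx
      (hreg' v (abs_le.2 hv))).hasDerivWithinAt)
    (fun v hv => hderiv v (abs_le.2 hv)) ⟨by simp, by simp⟩ (abs_le.1 le_rfl)
  calc |logDensityRatio n x w - logDensityRatio n x 0|
      ≤ invSqrt n ^ 3 * (C * (1 + |w|) ^ k) / (η / 2) ^ 3 * |w| := by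
        simpa only [Real.norm_eq_abs, sub_zero] using hle
    _ ≤ invSqrt n ^ 3 * (C * (1 + |w|) ^ k) / (η / 2) ^ 3 * (1 + |w|) := by
        gcongr
        linarith
    _ = invSqrt n ^ 3 * (C / (η / 2) ^ 3 * (1 + |w|) ^ (k + 1)) := by ring

/-! ### Gaussian comparison -/

local notation "Φ" => cdf (gaussianReal 0 1)

local notation "φ" => gaussianPDFReal 0 1

theorem continuous_gaussianPDFReal_std : Continuous φ := by
  rw [gaussianPDFReal_def]
  fun_prop

theorem cdf_gaussianReal_std_sub (a b : ℝ) : Φ b - Φ a = ∫ t in a..b, φ t := by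
  have h : ∀ c, Φ c = ∫ t in Set.Iic c, φ t := fun c => by
    rw [cdf_eq_real, measureReal_def, gaussianReal_apply_eq_integral 0 one_ne_zero,
      ENNReal.toReal_ofReal (integral_nonneg fun t => gaussianPDFReal_nonneg 0 1 t)]
  rw [h, h]
  exact intervalIntegral.integral_Iic_sub_Iic (integrable_gaussianPDFReal 0 1).integrableOn
    (integrable_gaussianPDFReal 0 1).integrableOn

theorem hasDerivAt_cdf_gaussianReal_std (w : ℝ) : HasDerivAt Φ (φ w) w := by
  have h := continuous_gaussianPDFReal_std.integral_hasStrictDerivAt 0 w |>.hasDerivAt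
  refine (h.const_add (Φ 0)).congr_of_eventuallyEq (.of_forall fun v => ?_)
  simp only [← cdf_gaussianReal_std_sub, add_sub_cancel]

theorem strictMono_cdf_gaussianReal_std : StrictMono Φ :=
  strictMono_of_deriv_pos fun w => by
    rw [(hasDerivAt_cdf_gaussianReal_std w).deriv]
    exact gaussianPDFReal_pos 0 1 w one_ne_zero

theorem continuous_cdf_gaussianReal_std : Continuous Φ :=
  continuous_iff_continuousAt.2 fun w => (hasDerivAt_cdf_gaussianReal_std w).continuousAt

theorem cdf_normalUpperQuantile {α : ℝ} (hα0 : 0 < α) (hα1 : α < 1) :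
    Φ (normalUpperQuantile α) = 1 - α := by
  obtain ⟨z, hz⟩ : ∃ z, Φ z = 1 - α :=
    mem_range_of_exists_le_of_exists_ge continuous_cdf_gaussianReal_std
      ((tendsto_cdf_atBot _).eventually (ge_mem_nhds (by linarith))).exists
      ((tendsto_cdf_atTop _).eventually (le_mem_nhds (by linarith))).exists
  have hset : {w : ℝ | 1 - α ≤ Φ w} = Set.Ici z := by
    ext w
    rw [Set.mem_ofPred_eq, ← hz, strictMono_cdf_gaussianReal_std.le_iff_le, Set.mem_Ici]
  rw [normalUpperQuantile, hset, csInf_Ici, hz]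

theorem cdf_gaussianReal_std_neg_le {W : ℝ} (hW : 0 ≤ W) : Φ (-W) ≤ Real.exp (-(W ^ 2 / 2)) := by
  have h := measure_le_le_exp_mul_mgf (X := id) (-W) (neg_nonpos.2 hW)
    (integrable_exp_mul_gaussianReal (μ := 0) (v := 1) (-W))
  rw [mgf_id_gaussianReal, ← Real.exp_add] at h
  rw [cdf_eq_real]
  refine h.trans_eq (congrArg Real.exp ?_)
  push_cast
  ring

theorem one_sub_cdf_gaussianReal_std_le {W : ℝ} (hW : 0 ≤ W) :
    1 - Φ W ≤ Real.exp (-(W ^ 2 / 2)) := by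
  have h := measure_ge_le_exp_mul_mgf (X := id) W hW
    (integrable_exp_mul_gaussianReal (μ := 0) (v := 1) W)
  rw [mgf_id_gaussianReal, ← Real.exp_add] at h
  rw [cdf_eq_real, ← probReal_compl_eq_one_sub measurableSet_Iic]
  have hsub : (Set.Iic W)ᶜ ⊆ {w | W ≤ id w} := by
    rw [Set.compl_Iic]
    exact Set.Ioi_subset_Ici_self
  refine (measureReal_mono hsub).trans (h.trans_eq (congrArg Real.exp ?_))
  push_cast
  ring

theorem mul_sub_le_cdf_gaussianReal_std_sub {r a b : ℝ} (ha : -r ≤ a) (hab : a ≤ b) (hb : b ≤ r) :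
    φ r * (b - a) ≤ Φ b - Φ a := by
  refine (convex_Icc a b).mul_sub_le_image_sub_of_le_deriv
    continuous_cdf_gaussianReal_std.continuousOn
    (fun v _ => (hasDerivAt_cdf_gaussianReal_std v).differentiableAt.differentiableWithinAt)
    (fun v hv => ?_) a (Set.left_mem_Icc.2 hab) b (Set.right_mem_Icc.2 hab) hab
  obtain ⟨hv₁, hv₂⟩ := interior_subset hv
  rw [(hasDerivAt_cdf_gaussianReal_std v).deriv]
  simp only [gaussianPDFReal, sub_zero]
  have hsq : v ^ 2 ≤ r ^ 2 := sq_le_sq' (ha.trans hv₁) (hv₂.trans hb)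
  gcongr

theorem integrable_one_add_abs_pow_mul_gaussianPDFReal (k : ℕ) :
    Integrable (fun w : ℝ => (1 + |w|) ^ k * φ w) := by
  have h : Integrable (fun w : ℝ => (1 + |w|) ^ k) (gaussianReal 0 1) := by
    have := ((memLp_const (1 : ℝ)).add
      (memLp_id_gaussianReal (μ := 0) (v := 1) (k : NNReal)).norm).integrable_norm_pow'
    simpa [abs_of_nonneg, add_nonneg] using this
  rw [gaussianReal_of_var_ne_zero 0 one_ne_zero, integrable_withDensity_iff
    (measurable_gaussianPDF 0 1) (.of_forall fun _ => gaussianPDF_lt_top)] at h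
  simpa only [toReal_gaussianPDF] using h

theorem abs_sub_sub_mul_cdf_gaussianReal_std_le {F E : ℝ → ℝ} {κ ε a b : ℝ} {k : ℕ} (hab : a ≤ b)
    (hκ : 0 ≤ κ)
    (hF : ∀ w ∈ Set.Icc a b, HasDerivAt F (-(κ * φ w * E w)) w)
    (hE : ∀ w ∈ Set.Icc a b, |E w - 1| ≤ ε * (1 + |w|) ^ k) :
    |F a - F b - κ * (Φ b - Φ a)| ≤ κ * (ε * ∫ w, (1 + |w|) ^ k * φ w) := by
  have hφ := gaussianPDFReal_nonneg 0 1
  have hε : 0 ≤ ε := by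
    have h := (abs_nonneg _).trans (hE a (Set.left_mem_Icc.2 hab))
    exact nonneg_of_mul_nonneg_left h (by positivity)
  have hcont : Continuous fun w : ℝ => (1 + |w|) ^ k * φ w :=
    (by fun_prop : Continuous fun w : ℝ => (1 + |w|) ^ k).mul continuous_gaussianPDFReal_std
  have hG : ∀ w ∈ Set.Icc a b, HasDerivAt (fun v => F v - F a + κ * (Φ v - Φ a))
      (-(κ * φ w * E w) + κ * φ w) w := fun w hw =>
    ((hF w hw).sub_const _).add (((hasDerivAt_cdf_gaussianReal_std w).sub_const _).const_mul κ)
  have hle : |F b - F a + κ * (Φ b - Φ a)| ≤ κ * (ε * ∫ w in a..b, (1 + |w|) ^ k * φ w) := by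
    refine image_norm_le_of_norm_deriv_right_le_deriv_boundary
      (B := fun v => κ * (ε * ∫ w in a..v, (1 + |w|) ^ k * φ w))
      (fun w hw => (hG w hw).continuousAt.continuousWithinAt)
      (fun w hw => (hG w (Set.Ico_subset_Icc_self hw)).hasDerivWithinAt) (by simp)
      (fun w => ((hcont.integral_hasStrictDerivAt a w).hasDerivAt.const_mul ε).const_mul κ)
      (fun w hw => ?_) (Set.right_mem_Icc.2 hab)
    calc ‖-(κ * φ w * E w) + κ * φ w‖ = κ * φ w * |E w - 1| := by
          rw [Real.norm_eq_abs, ← abs_of_nonneg (mul_nonneg hκ (hφ w)), ← abs_mul, ← abs_neg,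
            abs_of_nonneg (mul_nonneg hκ (hφ w))]
          ring_nf
      _ ≤ κ * φ w * (ε * (1 + |w|) ^ k) :=
          mul_le_mul_of_nonneg_left (hE w (Set.Ico_subset_Icc_self hw)) (mul_nonneg hκ (hφ w))
      _ = κ * (ε * ((1 + |w|) ^ k * φ w)) := by ring
  calc |F a - F b - κ * (Φ b - Φ a)| = |F b - F a + κ * (Φ b - Φ a)| := by
        rw [← abs_neg]; ring_nf
    _ ≤ κ * (ε * ∫ w in a..b, (1 + |w|) ^ k * φ w) := hle
    _ ≤ κ * (ε * ∫ w, (1 + |w|) ^ k * φ w) := by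
        gcongr
        rw [intervalIntegral.integral_of_le hab]
        exact setIntegral_le_integral (integrable_one_add_abs_pow_mul_gaussianPDFReal k)
          (.of_forall fun w => mul_nonneg (by positivity) (hφ w))

theorem abs_sub_one_le_of_abs_sub_mul_le {κ ε m g : ℝ} (hκ : 0 ≤ κ) (hε : ε ≤ 1 / 6)
    (h : |m - κ * g| ≤ κ * ε) (hm : m ∈ Set.Icc (1 - 2 * ε) 1)
    (hg : g ∈ Set.Icc (1 - 2 * ε) 1) : |κ - 1| ≤ 6 * ε := by
  obtain ⟨h₁, h₂⟩ := abs_le.1 h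
  have hup : κ * (1 - 3 * ε) ≤ 1 := by nlinarith [hg.1, hm.2]
  have hlo : 1 - 2 * ε ≤ κ * (1 + ε) := by nlinarith [hg.2, hm.1]
  have hε₀ : 0 ≤ ε := by linarith [hm.1, hm.2]
  exact abs_le.2 ⟨by nlinarith, by nlinarith⟩

theorem abs_sub_one_sub_cdf_gaussianReal_std_le {F : ℝ → ℝ} {κ ε W : ℝ} (hκ : 0 ≤ κ)
    (hε : ε ≤ 1 / 6)
    (hF : ∀ a b, -W ≤ a → a ≤ b → b ≤ W → |F a - F b - κ * (Φ b - Φ a)| ≤ κ * ε)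
    (hleft : F (-W) ∈ Set.Icc (1 - ε) 1) (hright : F W ∈ Set.Icc 0 ε)
    (hΦleft : Φ (-W) ≤ ε) (hΦright : 1 - Φ W ≤ ε) {w : ℝ} (hw : |w| ≤ W) :
    |F w - (1 - Φ w)| ≤ 10 * ε := by
  obtain ⟨hw₁, hw₂⟩ := abs_le.1 hw
  have hΦ₀ := cdf_nonneg (gaussianReal 0 1) (-W)
  have hΦ₁ := cdf_le_one (gaussianReal 0 1) W
  have hmass := hF (-W) W le_rfl (hw₁.trans hw₂) le_rfl
  have hκ₁ : |κ - 1| ≤ 6 * ε := abs_sub_one_le_of_abs_sub_mul_le hκ hε hmass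
    ⟨by linarith [hleft.1, hright.2], by linarith [hleft.2, hright.1]⟩
    ⟨by linarith, by linarith⟩
  have hprod : |(κ - 1) * (Φ W - Φ w)| ≤ 6 * ε := by
    have h₀ : 0 ≤ Φ W - Φ w := sub_nonneg.2 (monotone_cdf _ hw₂)
    rw [abs_mul, abs_of_nonneg h₀]
    exact (mul_le_of_le_one_right (abs_nonneg _)
      (by linarith [cdf_nonneg (gaussianReal 0 1) w])).trans hκ₁
  have hκε : κ * ε ≤ 2 * ε := by
    have hε₀ : 0 ≤ ε := hright.1.trans hright.2
    gcongr
    linarith [(abs_le.1 hκ₁).2]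
  obtain ⟨hp₁, hp₂⟩ := abs_le.1 hprod
  obtain ⟨hi₁, hi₂⟩ := abs_le.1 (hF w W hw₁ hw₂ le_rfl)
  exact abs_le.2 ⟨by linarith [hright.1], by linarith [hright.2]⟩

/-! ### Binomial means and tails -/

/-- The mean of `f X` for `X` binomial with parameters `n` and `θ`, as a polynomial in `θ`. -/
noncomputable def binomialMean (n : ℕ) (θ : ℝ) (f : ℕ → ℝ) : ℝ :=
  ∑ k ∈ Finset.range (n + 1), (n.choose k : ℝ) * θ ^ k * (1 - θ) ^ (n - k) * f k

theorem integral_binomial_eq_binomialMean (n : ℕ) {θ : ℝ} (hθ : θ ∈ Set.Icc (0 : ℝ) 1)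
    (f : ℕ → ℝ) : ∫ x, f x ∂(binomial n ⟨θ, hθ⟩) = binomialMean n θ f := by
  rw [integral_binomial, binomialMean]
  refine Finset.sum_congr ?_ fun k _ => by simp
  ext k
  simp

theorem binomialMean_add (n : ℕ) (θ : ℝ) (f g : ℕ → ℝ) :
    binomialMean n θ (fun k => f k + g k) = binomialMean n θ f + binomialMean n θ g := by
  simp only [binomialMean, mul_add, Finset.sum_add_distrib]

theorem binomialMean_sub (n : ℕ) (θ : ℝ) (f g : ℕ → ℝ) :
    binomialMean n θ (fun k => f k - g k) = binomialMean n θ f - binomialMean n θ g := by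
  simp only [binomialMean, mul_sub, Finset.sum_sub_distrib]

theorem binomialMean_const_mul (n : ℕ) (θ c : ℝ) (f : ℕ → ℝ) :
    binomialMean n θ (fun k => c * f k) = c * binomialMean n θ f := by
  simp only [binomialMean, Finset.mul_sum, mul_left_comm c]

theorem binomialMean_const (n : ℕ) (θ c : ℝ) : binomialMean n θ (fun _ => c) = c := by
  have hsum := add_pow θ (1 - θ) n
  rw [add_sub_cancel, one_pow] at hsum
  rw [binomialMean, ← Finset.sum_mul]
  conv_rhs => rw [← one_mul c, hsum]
  congr 1
  exact Finset.sum_congr rfl fun k _ => by ring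

theorem binomialMean_mono {n : ℕ} {θ : ℝ} (hθ : θ ∈ Set.Icc (0 : ℝ) 1) {f g : ℕ → ℝ}
    (h : ∀ k ≤ n, f k ≤ g k) : binomialMean n θ f ≤ binomialMean n θ g := by
  refine Finset.sum_le_sum fun k hk => ?_
  have hk : k ≤ n := Nat.lt_succ_iff.1 (Finset.mem_range.1 hk)
  have hθ0 : 0 ≤ θ := hθ.1
  have hθ1 : 0 ≤ 1 - θ := sub_nonneg.2 hθ.2
  gcongr
  exact h k hk

theorem abs_binomialMean_le {n : ℕ} {θ : ℝ} (hθ : θ ∈ Set.Icc (0 : ℝ) 1) {f g : ℕ → ℝ}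
    (h : ∀ k ≤ n, |f k| ≤ g k) : |binomialMean n θ f| ≤ binomialMean n θ g := by
  have hneg := binomialMean_const_mul n θ (-1) g
  refine abs_le.2 ⟨?_, binomialMean_mono hθ fun k hk => (abs_le.1 (h k hk)).2⟩
  rw [← neg_one_mul, ← hneg]
  exact binomialMean_mono hθ fun k hk => by linarith [(abs_le.1 (h k hk)).1]

theorem binomialMean_succ (n : ℕ) (θ : ℝ) (f : ℕ → ℝ) :
    binomialMean (n + 1) θ f = binomialMean n θ fun k => θ * f (k + 1) + (1 - θ) * f k := by
  have hfail : ∑ k ∈ Finset.range (n + 1),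
      (n.choose (k + 1) : ℝ) * θ ^ (k + 1) * (1 - θ) ^ (n - k) * f (k + 1) +
        (1 - θ) ^ (n + 1) * f 0 =
      binomialMean n θ fun k => (1 - θ) * f k := by
    have h := Finset.sum_range_succ'
      (fun k => (n.choose k : ℝ) * θ ^ k * (1 - θ) ^ (n + 1 - k) * f k) (n + 1)
    rw [Finset.sum_range_succ] at h
    simp only [Nat.choose_succ_self, Nat.cast_zero, zero_mul, add_zero, Nat.choose_zero_right,
      Nat.cast_one, pow_zero, one_mul, Nat.sub_zero, Nat.add_sub_add_right] at h
    rw [← h]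
    refine Finset.sum_congr rfl fun k hk => ?_
    rw [Nat.succ_sub (Nat.lt_succ_iff.1 (Finset.mem_range.1 hk)), pow_succ]
    ring
  rw [binomialMean_add, ← hfail, binomialMean, Finset.sum_range_succ']
  simp only [Nat.choose_zero_right, Nat.cast_one, pow_zero, one_mul, Nat.sub_zero,
    Nat.add_sub_add_right, Nat.choose_succ_succ, Nat.cast_add, add_mul, Finset.sum_add_distrib]
  rw [add_assoc]
  congr 1
  exact Finset.sum_congr rfl fun k _ => by ring

theorem binomialMean_centered (n : ℕ) (θ : ℝ) :
    binomialMean n θ (fun k => (k : ℝ) - n * θ) = 0 := by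
  induction n with
  | zero => simp [binomialMean]
  | succ n ih =>
    rw [binomialMean_succ, ← ih]
    congr 1
    funext k
    push_cast
    ring

theorem binomialMean_centered_sq (n : ℕ) (θ : ℝ) :
    binomialMean n θ (fun k => ((k : ℝ) - n * θ) ^ 2) = n * (θ * (1 - θ)) := by
  induction n with
  | zero => simp [binomialMean]
  | succ n ih =>
    have hstep : (fun k : ℕ => θ * (((k + 1 : ℕ) : ℝ) - ((n + 1 : ℕ) : ℝ) * θ) ^ 2 +
        (1 - θ) * ((k : ℝ) - ((n + 1 : ℕ) : ℝ) * θ) ^ 2) =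
        fun k : ℕ => ((k : ℝ) - n * θ) ^ 2 + θ * (1 - θ) := by
      funext k
      push_cast
      ring
    rw [binomialMean_succ, hstep, binomialMean_add, ih, binomialMean_const]
    push_cast
    ring

theorem binomialMean_centered_pow_four_le (n : ℕ) {θ : ℝ} (hθ : θ ∈ Set.Icc (0 : ℝ) 1) :
    binomialMean n θ (fun k => ((k : ℝ) - n * θ) ^ 4) ≤ n ^ 2 := by
  induction n with
  | zero => simp [binomialMean]
  | succ n ih =>
    have hstep : (fun k : ℕ => θ * (((k + 1 : ℕ) : ℝ) - ((n + 1 : ℕ) : ℝ) * θ) ^ 4 +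
        (1 - θ) * ((k : ℝ) - ((n + 1 : ℕ) : ℝ) * θ) ^ 4) =
        fun k : ℕ => ((k : ℝ) - n * θ) ^ 4 + (6 * (θ * (1 - θ)) * ((k : ℝ) - n * θ) ^ 2 +
          (4 * (θ * (1 - θ) * (1 - 2 * θ)) * ((k : ℝ) - n * θ) +
            θ * (1 - θ) * (1 - 3 * (θ * (1 - θ))))) := by
      funext k
      push_cast
      ring
    rw [binomialMean_succ, hstep, binomialMean_add, binomialMean_add, binomialMean_add,
      binomialMean_const_mul, binomialMean_const_mul, binomialMean_centered,
      binomialMean_centered_sq, binomialMean_const]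
    have hvar0 : 0 ≤ θ * (1 - θ) := mul_nonneg hθ.1 (sub_nonneg.2 hθ.2)
    have hvar1 : θ * (1 - θ) ≤ 1 / 4 := by nlinarith [sq_nonneg (θ - 1 / 2)]
    generalize θ * (1 - θ) = v at *
    have hsq : n * (v * v) ≤ n * (1 / 4 * (1 / 4)) := by gcongr
    push_cast
    nlinarith

theorem binomialMean_exp_centered_le (n : ℕ) {θ t : ℝ} (hθ : θ ∈ Set.Icc (0 : ℝ) 1)
    (ht : |t| ≤ 1) :
    binomialMean n θ (fun k => Real.exp (t * (k - n * θ))) ≤ Real.exp (n * t ^ 2) := by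
  have hθ0 : 0 ≤ θ := hθ.1
  have hθ1 : 0 ≤ 1 - θ := sub_nonneg.2 hθ.2
  have exp_le {u : ℝ} (hu : |u| ≤ 1) : Real.exp u ≤ 1 + u + u ^ 2 := by
    linarith [(abs_le.1 (Real.abs_exp_sub_one_sub_id_le hu)).2]
  have hsingle : θ * Real.exp (t * (1 - θ)) + (1 - θ) * Real.exp (-(t * θ)) ≤
      Real.exp (t ^ 2) := by
    calc θ * Real.exp (t * (1 - θ)) + (1 - θ) * Real.exp (-(t * θ))
        ≤ θ * (1 + t * (1 - θ) + (t * (1 - θ)) ^ 2) +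
            (1 - θ) * (1 + -(t * θ) + (-(t * θ)) ^ 2) := by
          gcongr <;> apply exp_le
          · rw [abs_mul, abs_of_nonneg hθ1]; nlinarith [abs_nonneg t]
          · rw [abs_neg, abs_mul, abs_of_nonneg hθ0]; nlinarith [abs_nonneg t]
      _ = t ^ 2 * (θ * (1 - θ)) + 1 := by ring
      _ ≤ t ^ 2 + 1 := by nlinarith [sq_nonneg t, sq_nonneg θ]
      _ ≤ Real.exp (t ^ 2) := Real.add_one_le_exp _
  induction n with
  | zero => simp [binomialMean]
  | succ n ih =>
    have hstep : (fun k : ℕ => θ * Real.exp (t * (((k + 1 : ℕ) : ℝ) - ((n + 1 : ℕ) : ℝ) * θ)) +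
        (1 - θ) * Real.exp (t * ((k : ℝ) - ((n + 1 : ℕ) : ℝ) * θ))) =
        fun k : ℕ => (θ * Real.exp (t * (1 - θ)) + (1 - θ) * Real.exp (-(t * θ))) *
          Real.exp (t * (k - n * θ)) := by
      funext k
      rw [add_mul, mul_assoc, mul_assoc, ← Real.exp_add, ← Real.exp_add]
      push_cast
      ring_nf
    rw [binomialMean_succ, hstep, binomialMean_const_mul, Nat.cast_succ, add_one_mul,
      Real.exp_add, mul_comm (Real.exp _)]
    have hnonneg : 0 ≤ binomialMean n θ (fun k => Real.exp (t * (k - n * θ))) := by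
      simpa only [binomialMean_const] using
        binomialMean_mono hθ (f := fun _ => 0) fun k _ => (Real.exp_pos (t * (k - n * θ))).le
    gcongr

theorem binomialLowerTail_eq_binomialMean {n x : ℕ} (hx : x ≤ n) (θ : ℝ) :
    binomialLowerTail n x θ = binomialMean n θ fun k => if k ≤ x then 1 else 0 := by
  simp only [binomialLowerTail, binomialMean, mul_ite, mul_one, mul_zero, ← Finset.sum_filter]
  congr 1
  ext k
  simp only [Finset.mem_range, Finset.mem_filter]
  omega

theorem one_sub_binomialLowerTail_eq_binomialMean {n x : ℕ} (hx : x ≤ n) (θ : ℝ) :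
    1 - binomialLowerTail n x θ = binomialMean n θ fun k => if k ≤ x then 0 else 1 := by
  rw [sub_eq_iff_eq_add, binomialLowerTail_eq_binomialMean hx, ← binomialMean_add]
  conv_lhs => rw [← binomialMean_const n θ 1]
  congr 1
  funext k
  split_ifs <;> norm_num

theorem binomialLowerTail_mem_Icc {n x : ℕ} {θ : ℝ} (hx : x ≤ n) (hθ : θ ∈ Set.Icc (0 : ℝ) 1) :
    binomialLowerTail n x θ ∈ Set.Icc (0 : ℝ) 1 := by
  rw [binomialLowerTail_eq_binomialMean hx]
  constructor
  · refine (binomialMean_const n θ 0).symm.trans_le ?_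
    exact binomialMean_mono hθ fun k _ => by split_ifs <;> norm_num
  · refine le_of_le_of_eq ?_ (binomialMean_const n θ 1)
    exact binomialMean_mono hθ fun k _ => by split_ifs <;> norm_num

theorem binomialMean_exp_sub_le {n x : ℕ} {θ : ℝ} (hn : 0 < n) (hx : x ≤ n)
    (hθ : θ ∈ Set.Icc (0 : ℝ) 1) :
    binomialMean n θ (fun k => Real.exp ((x / n - θ) / 2 * (k - x))) ≤
      Real.exp (-(n * (θ - x / n) ^ 2 / 4)) := by
  have hn0 : (n : ℝ) ≠ 0 := by positivity
  have hx0 : 0 ≤ (x : ℝ) / n := by positivity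
  have hx1 : (x : ℝ) / n ≤ 1 := div_le_one_of_le₀ (by exact_mod_cast hx) (by positivity)
  set t : ℝ := (x / n - θ) / 2 with ht
  have ht1 : |t| ≤ 1 := abs_le.2 ⟨by linarith [hθ.2], by linarith [hθ.1]⟩
  have hshift (k : ℕ) : Real.exp (t * (k - x)) =
      Real.exp (t * (n * θ - x)) * Real.exp (t * (k - n * θ)) := by
    rw [← Real.exp_add]
    ring_nf
  simp_rw [hshift]
  rw [binomialMean_const_mul]
  calc Real.exp (t * (n * θ - x)) * binomialMean n θ (fun k => Real.exp (t * (k - n * θ)))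
      ≤ Real.exp (t * (n * θ - x)) * Real.exp (n * t ^ 2) := by
        gcongr
        exact binomialMean_exp_centered_le n hθ ht1
    _ = Real.exp (-(n * (θ - x / n) ^ 2 / 4)) := by
        rw [← Real.exp_add, ht]
        congr 1
        field_simp
        ring

theorem binomialLowerTail_le_exp {n x : ℕ} {θ : ℝ} (hn : 0 < n) (hx : x ≤ n)
    (hθ : θ ∈ Set.Icc (0 : ℝ) 1) (h : (x / n : ℝ) ≤ θ) :
    binomialLowerTail n x θ ≤ Real.exp (-(n * (θ - x / n) ^ 2 / 4)) := by
  refine le_trans ?_ (binomialMean_exp_sub_le hn hx hθ)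
  rw [binomialLowerTail_eq_binomialMean hx]
  refine binomialMean_mono hθ fun k _ => ?_
  split_ifs with hkx
  · have hkx : (k : ℝ) ≤ x := by exact_mod_cast hkx
    exact Real.one_le_exp (by nlinarith)
  · positivity

theorem one_sub_binomialLowerTail_le_exp {n x : ℕ} {θ : ℝ} (hn : 0 < n) (hx : x ≤ n)
    (hθ : θ ∈ Set.Icc (0 : ℝ) 1) (h : θ ≤ x / n) :
    1 - binomialLowerTail n x θ ≤ Real.exp (-(n * (θ - x / n) ^ 2 / 4)) := by
  refine le_trans ?_ (binomialMean_exp_sub_le hn hx hθ)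
  rw [one_sub_binomialLowerTail_eq_binomialMean hx]
  refine binomialMean_mono hθ fun k _ => ?_
  split_ifs with hkx
  · positivity
  · have hkx : (x : ℝ) ≤ k := by exact_mod_cast (not_le.1 hkx).le
    exact Real.one_le_exp (by nlinarith)

theorem strictAntiOn_binomialLowerTail {n x : ℕ} (hx : x < n) :
    StrictAntiOn (binomialLowerTail n x) (Set.Icc 0 1) := by
  refine strictAntiOn_of_deriv_neg (convex_Icc 0 1)
    (fun θ _ => (hasDerivAt_binomialLowerTail hx θ).continuousAt.continuousWithinAt) fun θ hθ => ?_
  rw [interior_Icc] at hθ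
  rw [(hasDerivAt_binomialLowerTail hx θ).deriv, neg_lt_zero]
  have hchoose : (0 : ℝ) < n.choose x := by exact_mod_cast Nat.choose_pos hx.le
  have hsub : (0 : ℝ) < ((n - x : ℕ) : ℝ) := by exact_mod_cast Nat.sub_pos_of_lt hx
  have hθ0 : 0 < θ := hθ.1
  have hθ1 : 0 < 1 - θ := sub_pos.2 hθ.2
  positivity

/-! ### The binomial lower tail along the approximate quantile -/

/-- The ratio, at `w = 0`, of the derivative in `w` of the binomial lower tail at
`betaQuantileApprox (x / n) (invSqrt n) w` to minus the standard normal density. -/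
noncomputable def tailDensityScale (n x : ℕ) : ℝ :=
  n.choose x * (n - x : ℕ) * invSqrt n * √(2 * Real.pi) * Real.exp (logDensityRatio n x 0)

theorem tailDensityScale_nonneg (n x : ℕ) : 0 ≤ tailDensityScale n x := by
  have := invSqrt_nonneg n
  rw [tailDensityScale]
  positivity

theorem hasDerivAt_binomialLowerTail_betaQuantileApprox {n x : ℕ} {η w : ℝ} (hη : 0 < η)
    (hx : x < n) (h : IsQuantileRegular η (x / n) (invSqrt n) w) :
    HasDerivAt (fun v => binomialLowerTail n x (betaQuantileApprox (x / n) (invSqrt n) v))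
      (-(tailDensityScale n x * φ w *
        Real.exp (logDensityRatio n x w - logDensityRatio n x 0))) w := by
  refine ((hasDerivAt_binomialLowerTail hx _).comp w
    (hasDerivAt_betaQuantileApprox (x / n) (invSqrt n) w)).congr_deriv ?_
  have hφ : φ w = (√(2 * Real.pi))⁻¹ * (Real.exp (w ^ 2 / 2))⁻¹ := by
    simp [gaussianPDFReal, ← Real.exp_neg, neg_div]
  rw [tailDensityScale, Real.exp_sub, exp_logDensityRatio hη h, hφ]
  field_simp

theorem eventually_exp_neg_mul_log_sq_le {c : ℝ} (hc : 0 < c) :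
    ∀ᶠ n : ℕ in atTop, Real.exp (-(c * Real.log n ^ 2)) ≤ invSqrt n ^ 3 := by
  filter_upwards [(Real.tendsto_log_atTop.comp tendsto_natCast_atTop_atTop).eventually_ge_atTop
    (3 / 2 / c), eventually_gt_atTop 0] with n hlog hn
  have hlog : 3 / 2 ≤ Real.log n * c := (div_le_iff₀ hc).1 hlog
  rw [← Real.le_log_iff_exp_le (pow_pos (invSqrt_pos hn) 3), Real.log_pow, invSqrt, Real.log_inv,
    Real.log_sqrt n.cast_nonneg]
  push_cast
  nlinarith [Real.log_natCast_nonneg n]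

theorem natCast_mul_betaQuantileApprox_sub_sq {n : ℕ} (hn : 0 < n) (y w : ℝ) :
    n * (betaQuantileApprox y (invSqrt n) w - y) ^ 2 = quantileDev y (invSqrt n) w ^ 2 := by
  rw [betaQuantileApprox, add_sub_cancel_left, mul_pow, ← mul_assoc,
    natCast_mul_invSqrt_sq hn.ne', one_mul]

theorem exp_neg_mul_betaQuantileApprox_sub_sq_le {n : ℕ} {η y w : ℝ} (hn : 0 < n) (hη : 0 < η)
    (h : η / 2 * Real.log n ≤ |quantileDev y (invSqrt n) w|) :
    Real.exp (-(n * (betaQuantileApprox y (invSqrt n) w - y) ^ 2 / 4)) ≤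
      Real.exp (-(η ^ 2 / 16 * Real.log n ^ 2)) := by
  have hsq : (η / 2 * Real.log n) ^ 2 ≤ quantileDev y (invSqrt n) w ^ 2 := by
    rw [← sq_abs (quantileDev _ _ _)]
    gcongr
  rw [natCast_mul_betaQuantileApprox_sub_sq hn, Real.exp_le_exp]
  linarith

namespace IsQuantileRegular

variable {η y e w : ℝ}

theorem le_quantileDev (h : IsQuantileRegular η y e w) (hη : 0 < η) (hy : y ∈ Set.Icc η (1 - η))
    (hw : 1 ≤ w) : η / 2 * w ≤ quantileDev y e w := by
  have hσ : η * w ≤ bernoulliStd y * w := by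
    gcongr
    exact le_bernoulliStd hη hy
  nlinarith [(abs_le.1 h.abs_dev_sub_le).1]

theorem quantileDev_le (h : IsQuantileRegular η y e w) (hη : 0 < η) (hy : y ∈ Set.Icc η (1 - η))
    (hw : w ≤ -1) : quantileDev y e w ≤ η / 2 * w := by
  have hσ : bernoulliStd y * w ≤ η * w :=
    mul_le_mul_of_nonpos_right (le_bernoulliStd hη hy) (by linarith)
  nlinarith [(abs_le.1 h.abs_dev_sub_le).2]

end IsQuantileRegular

theorem eventually_binomialLowerTail_log_mem_Icc {η : ℝ} (hη : 0 < η) :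
    ∀ᶠ n : ℕ in atTop, ∀ x : ℕ, (x / n : ℝ) ∈ Set.Icc η (1 - η) →
      binomialLowerTail n x (betaQuantileApprox (x / n) (invSqrt n) (-Real.log n)) ∈
          Set.Icc (1 - invSqrt n ^ 3) 1 ∧
        binomialLowerTail n x (betaQuantileApprox (x / n) (invSqrt n) (Real.log n)) ∈
          Set.Icc 0 (invSqrt n ^ 3) := by
  filter_upwards [eventually_isQuantileRegular hη,
    eventually_exp_neg_mul_log_sq_le (show 0 < η ^ 2 / 16 by positivity),
    (Real.tendsto_log_atTop.comp tendsto_natCast_atTop_atTop).eventually_ge_atTop 1,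
    eventually_gt_atTop 0] with n hreg hexp hlog hn x hx
  replace hlog : 1 ≤ Real.log n := hlog
  have he := invSqrt_pos hn
  have hxn := (lt_of_div_le_one_sub hη hn hx.2).le
  have hreg₁ := hreg (x / n) hx (-Real.log n) (by rw [abs_neg, abs_of_nonneg (by linarith)])
  have hreg₂ := hreg (x / n) hx (Real.log n) (by rw [abs_of_nonneg (by linarith)])
  have hA₁ := hreg₁.quantileDev_le hη hx (neg_le_neg hlog)
  have hA₂ := hreg₂.le_quantileDev hη hx hlog
  have hpos : 0 < η / 2 * Real.log n := by positivity
  have htail₁ := one_sub_binomialLowerTail_le_exp hn hxn (hreg₁.approx_mem_Icc hη)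
    (by rw [betaQuantileApprox]; nlinarith)
  have htail₂ := binomialLowerTail_le_exp hn hxn (hreg₂.approx_mem_Icc hη)
    (by rw [betaQuantileApprox]; nlinarith)
  refine ⟨⟨?_, (binomialLowerTail_mem_Icc hxn (hreg₁.approx_mem_Icc hη)).2⟩,
    (binomialLowerTail_mem_Icc hxn (hreg₂.approx_mem_Icc hη)).1, ?_⟩
  · have hleft := exp_neg_mul_betaQuantileApprox_sub_sq_le hn hη
      (show _ ≤ |quantileDev (x / n) (invSqrt n) (-Real.log n)| from
        le_abs.2 (.inr (by linarith)))
    linarith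
  · exact htail₂.trans
      ((exp_neg_mul_betaQuantileApprox_sub_sq_le hn hη (le_abs.2 (.inl hA₂))).trans hexp)

theorem eventually_abs_exp_logDensityRatio_sub_le {η : ℝ} (hη : 0 < η) :
    ∃ C : ℝ, 0 ≤ C ∧ ∃ k : ℕ, ∀ᶠ n : ℕ in atTop, ∀ x : ℕ, (x / n : ℝ) ∈ Set.Icc η (1 - η) →
      ∀ w, |w| ≤ Real.log n →
        |Real.exp (logDensityRatio n x w - logDensityRatio n x 0) - 1| ≤
          C * invSqrt n ^ 3 * (1 + |w|) ^ k := by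
  obtain ⟨C, hC, k, hratio⟩ := eventually_abs_logDensityRatio_sub_le hη
  refine ⟨2 * C, by positivity, k, ?_⟩
  filter_upwards [hratio, (tendsto_invSqrt_mul_one_add_log_pow C k).eventually_le_const one_pos]
    with n hratio hsmall x hx w hw
  have he := invSqrt_nonneg n
  have he₃ : invSqrt n ^ 3 ≤ invSqrt n := pow_le_of_le_one he (invSqrt_le_one n) three_ne_zero
  have h := hratio x hx w hw
  have hle : invSqrt n ^ 3 * (C * (1 + |w|) ^ k) ≤ 1 := le_trans (by gcongr) hsmall
  linarith [Real.abs_exp_sub_one_le (h.trans hle)]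

theorem eventually_abs_binomialLowerTail_sub_sub_le {η : ℝ} (hη : 0 < η) :
    ∃ C : ℝ, 0 ≤ C ∧ ∀ᶠ n : ℕ in atTop, ∀ x : ℕ, (x / n : ℝ) ∈ Set.Icc η (1 - η) →
      ∀ a b, -Real.log n ≤ a → a ≤ b → b ≤ Real.log n →
        |binomialLowerTail n x (betaQuantileApprox (x / n) (invSqrt n) a) -
            binomialLowerTail n x (betaQuantileApprox (x / n) (invSqrt n) b) -
              tailDensityScale n x * (Φ b - Φ a)| ≤
          tailDensityScale n x * (C * invSqrt n ^ 3) := by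
  obtain ⟨C, hC, k, hexp⟩ := eventually_abs_exp_logDensityRatio_sub_le hη
  refine ⟨C * ∫ w, (1 + |w|) ^ k * φ w, mul_nonneg hC (integral_nonneg fun w =>
    mul_nonneg (by positivity) (gaussianPDFReal_nonneg 0 1 w)), ?_⟩
  filter_upwards [hexp, eventually_isQuantileRegular hη, eventually_gt_atTop 0]
    with n hexp hreg hn x hx a b ha hab hb
  have hIcc : ∀ v ∈ Set.Icc a b, |v| ≤ Real.log n := fun v hv =>
    abs_le.2 ⟨ha.trans hv.1, hv.2.trans hb⟩
  rw [mul_right_comm]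
  exact abs_sub_sub_mul_cdf_gaussianReal_std_le hab (tailDensityScale_nonneg n x)
    (fun v hv => hasDerivAt_binomialLowerTail_betaQuantileApprox hη
      (lt_of_div_le_one_sub hη hn hx.2) (hreg _ hx v (hIcc v hv)))
    fun v hv => hexp x hx v (hIcc v hv)

theorem eventually_abs_binomialLowerTail_sub_le {η : ℝ} (hη : 0 < η) :
    ∃ K : ℝ, 0 ≤ K ∧ ∀ᶠ n : ℕ in atTop, ∀ x : ℕ, (x / n : ℝ) ∈ Set.Icc η (1 - η) →
      ∀ w, |w| ≤ Real.log n →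
        |binomialLowerTail n x (betaQuantileApprox (x / n) (invSqrt n) w) - (1 - Φ w)| ≤
          K * invSqrt n ^ 3 := by
  obtain ⟨C, hC, hdiff⟩ := eventually_abs_binomialLowerTail_sub_sub_le hη
  refine ⟨10 * (C + 1), by positivity, ?_⟩
  filter_upwards [hdiff, eventually_binomialLowerTail_log_mem_Icc hη,
    eventually_exp_neg_mul_log_sq_le (show (0 : ℝ) < 1 / 2 by norm_num),
    (tendsto_invSqrt_mul_one_add_log_pow (C + 1) 0).eventually_le_const
      (show (0 : ℝ) < 1 / 6 by norm_num)] with n hdiff htail hexp hsmall x hx w hw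
  have he := invSqrt_nonneg n
  have he₃ : invSqrt n ^ 3 ≤ invSqrt n := pow_le_of_le_one he (invSqrt_le_one n) three_ne_zero
  have hle : invSqrt n ^ 3 ≤ (C + 1) * invSqrt n ^ 3 :=
    le_mul_of_one_le_left (by positivity) (le_add_of_nonneg_left hC)
  have hε : (C + 1) * invSqrt n ^ 3 ≤ 1 / 6 := by
    rw [pow_zero, mul_one, mul_comm] at hsmall
    exact le_trans (by gcongr) hsmall
  rw [one_div_mul_eq_div] at hexp
  have hlog := Real.log_natCast_nonneg n
  obtain ⟨⟨hleft₀, hleft₁⟩, hright₀, hright₁⟩ := htail x hx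
  rw [mul_assoc 10]
  refine abs_sub_one_sub_cdf_gaussianReal_std_le
    (F := fun v => binomialLowerTail n x (betaQuantileApprox (x / n) (invSqrt n) v))
    (tailDensityScale_nonneg n x) hε (fun a b ha hab hb => ?_)
    ⟨by linarith, hleft₁⟩ ⟨hright₀, hright₁.trans hle⟩
    ((cdf_gaussianReal_std_neg_le hlog).trans (hexp.trans hle))
    ((one_sub_cdf_gaussianReal_std_le hlog).trans (hexp.trans hle)) hw
  refine (hdiff x hx a b ha hab hb).trans ?_
  gcongr
  · exact tailDensityScale_nonneg n x
  · linarith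

/-! ### Inversion of the tail -/

section Inversion

variable {α θ : ℝ} {n x : ℕ}

theorem clopperPearsonUpper_le_iff (hα0 : 0 < α) (hα1 : α < 1) (hx : x < n)
    (hθ : θ ∈ Set.Icc (0 : ℝ) 1) : clopperPearsonUpper α n x ≤ θ ↔ binomialLowerTail n x θ ≤ α := by
  obtain ⟨hU, htail⟩ := clopperPearsonUpper_spec hα0 hα1 hx
  rw [← (strictAntiOn_binomialLowerTail hx).le_iff_ge hθ hU, htail]

theorem le_clopperPearsonUpper_iff (hα0 : 0 < α) (hα1 : α < 1) (hx : x < n)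
    (hθ : θ ∈ Set.Icc (0 : ℝ) 1) : θ ≤ clopperPearsonUpper α n x ↔ α ≤ binomialLowerTail n x θ := by
  obtain ⟨hU, htail⟩ := clopperPearsonUpper_spec hα0 hα1 hx
  rw [← (strictAntiOn_binomialLowerTail hx).le_iff_ge hU hθ, htail]

theorem clopperPearsonUpper_mem_Icc (hα0 : 0 < α) (hα1 : α < 1) (hx : x ≤ n) :
    clopperPearsonUpper α n x ∈ Set.Icc (0 : ℝ) 1 := by
  obtain rfl | hx := hx.eq_or_lt
  · rw [clopperPearsonUpper_self hα1]
    exact Set.right_mem_Icc.2 zero_le_one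
  · exact (clopperPearsonUpper_spec hα0 hα1 hx).1

end Inversion

theorem abs_betaQuantileApprox_sub_le {η y e a b : ℝ} (he : 0 ≤ e) (hη : 0 < η)
    (h : ∀ v ∈ Set.uIcc a b, IsQuantileRegular η y e v) :
    |betaQuantileApprox y e b - betaQuantileApprox y e a| ≤ 2 * e * |b - a| := by
  refine (convex_uIcc a b).norm_image_sub_le_of_norm_hasDerivWithin_le
    (fun v _ => (hasDerivAt_betaQuantileApprox y e v).hasDerivWithinAt) (fun v hv => ?_)
    Set.left_mem_uIcc Set.right_mem_uIcc
  rw [Real.norm_eq_abs, abs_of_nonneg (mul_nonneg he ((h v hv).deriv_pos hη).le), mul_comm]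
  gcongr
  exact (h v hv).deriv_le

theorem clopperPearsonUpper_mem_Icc_betaQuantileApprox {α η δ r : ℝ} {n x : ℕ} (hα0 : 0 < α)
    (hα1 : α < 1) (hη : 0 < η) (hx : x < n) (hδ : 0 ≤ δ) (hr : |normalUpperQuantile α| + δ ≤ r)
    (hreg : ∀ w, |w| ≤ r → IsQuantileRegular η (x / n) (invSqrt n) w)
    (htail : ∀ w, |w| ≤ r →
      |binomialLowerTail n x (betaQuantileApprox (x / n) (invSqrt n) w) - (1 - Φ w)| ≤ φ r * δ) :
    clopperPearsonUpper α n x ∈ Set.Icc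
      (betaQuantileApprox (x / n) (invSqrt n) (normalUpperQuantile α - δ))
      (betaQuantileApprox (x / n) (invSqrt n) (normalUpperQuantile α + δ)) := by
  have hΦz : Φ (normalUpperQuantile α) = 1 - α := cdf_normalUpperQuantile hα0 hα1
  set z := normalUpperQuantile α
  have hz := abs_le.1 (le_refl |z|)
  have hleft : |z - δ| ≤ r := abs_le.2 ⟨by linarith, by linarith⟩
  have hright : |z + δ| ≤ r := abs_le.2 ⟨by linarith, by linarith⟩
  constructor
  · rw [le_clopperPearsonUpper_iff hα0 hα1 hx ((hreg _ hleft).approx_mem_Icc hη)]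
    have hΦ := mul_sub_le_cdf_gaussianReal_std_sub (abs_le.1 hleft).1 (sub_le_self z hδ)
      (by linarith)
    rw [sub_sub_cancel] at hΦ
    linarith [(abs_le.1 (htail _ hleft)).1]
  · rw [clopperPearsonUpper_le_iff hα0 hα1 hx ((hreg _ hright).approx_mem_Icc hη)]
    have hΦ := mul_sub_le_cdf_gaussianReal_std_sub (show -r ≤ z by linarith)
      (le_add_of_nonneg_right hδ) (abs_le.1 hright).2
    rw [add_sub_cancel_left] at hΦ
    linarith [(abs_le.1 (htail _ hright)).2]

theorem abs_clopperPearsonUpper_sub_le {α η δ r : ℝ} {n x : ℕ} (hα0 : 0 < α)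
    (hα1 : α < 1) (hη : 0 < η) (hx : x < n) (hδ : 0 ≤ δ) (hr : |normalUpperQuantile α| + δ ≤ r)
    (hreg : ∀ w, |w| ≤ r → IsQuantileRegular η (x / n) (invSqrt n) w)
    (htail : ∀ w, |w| ≤ r →
      |binomialLowerTail n x (betaQuantileApprox (x / n) (invSqrt n) w) - (1 - Φ w)| ≤ φ r * δ) :
    |clopperPearsonUpper α n x - betaQuantileApprox (x / n) (invSqrt n) (normalUpperQuantile α)| ≤
      2 * invSqrt n * δ := by
  obtain ⟨hlower, hupper⟩ :=
    clopperPearsonUpper_mem_Icc_betaQuantileApprox hα0 hα1 hη hx hδ hr hreg htail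
  set z := normalUpperQuantile α
  have hz := abs_le.1 (le_refl |z|)
  have hlipschitz : ∀ b, |b - z| ≤ δ → |betaQuantileApprox (x / n) (invSqrt n) b -
      betaQuantileApprox (x / n) (invSqrt n) z| ≤ 2 * invSqrt n * δ := fun b hb => by
    have he := invSqrt_nonneg n
    refine (abs_betaQuantileApprox_sub_le he hη fun v hv => hreg v ?_).trans (by gcongr)
    have hv' := abs_le.1 ((Set.abs_sub_left_of_mem_uIcc hv).trans hb)
    exact abs_le.2 ⟨by linarith, by linarith⟩
  have hleft := abs_le.1 (hlipschitz (z - δ)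
    (by rw [sub_sub_cancel_left, abs_neg, abs_of_nonneg hδ]))
  have hright := abs_le.1 (hlipschitz (z + δ)
    (by rw [add_sub_cancel_left, abs_of_nonneg hδ]))
  exact abs_le.2 ⟨by linarith, by linarith⟩

theorem eventually_abs_clopperPearsonUpper_sub_le {α η : ℝ} (hα0 : 0 < α) (hα1 : α < 1)
    (hη : 0 < η) :
    ∃ K : ℝ, 0 ≤ K ∧ ∀ᶠ n : ℕ in atTop, ∀ x : ℕ, (x / n : ℝ) ∈ Set.Icc η (1 - η) →
      |clopperPearsonUpper α n x -
        betaQuantileApprox (x / n) (invSqrt n) (normalUpperQuantile α)| ≤ K * invSqrt n ^ 4 := by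
  obtain ⟨K, hK, htail⟩ := eventually_abs_binomialLowerTail_sub_le hη
  set r := |normalUpperQuantile α| + 1
  have hφ : 0 < φ r := gaussianPDFReal_pos 0 1 _ one_ne_zero
  refine ⟨2 * (K / φ r), by positivity, ?_⟩
  filter_upwards [htail, eventually_isQuantileRegular hη, eventually_gt_atTop 0,
    (Real.tendsto_log_atTop.comp tendsto_natCast_atTop_atTop).eventually_ge_atTop r,
    (tendsto_invSqrt_mul_one_add_log_pow (K / φ r) 0).eventually_le_const one_pos]
    with n htail hreg hn hlog hsmall x hx
  have he := invSqrt_nonneg n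
  have hδ : K / φ r * invSqrt n ^ 3 ≤ 1 := by
    rw [pow_zero, mul_one, mul_comm] at hsmall
    refine le_trans ?_ hsmall
    gcongr
    exact pow_le_of_le_one he (invSqrt_le_one n) three_ne_zero
  have hbound := abs_clopperPearsonUpper_sub_le hα0 hα1 hη (lt_of_div_le_one_sub hη hn hx.2)
    (by positivity) (show _ ≤ r from add_le_add_right hδ _)
    (fun w hw => hreg _ hx w (hw.trans hlog))
    (fun w hw => (htail x hx w (hw.trans hlog)).trans_eq (by field_simp))
  exact hbound.trans_eq (by ring)

/-! ### Expansion around the success probability -/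

theorem pow_mul_pow_le_pow_add_pow {a b : ℝ} (ha : 0 ≤ a) (hb : 0 ≤ b) (i j : ℕ) :
    a ^ i * b ^ j ≤ a ^ (i + j) + b ^ (i + j) := by
  obtain hab | hba := le_total a b
  · calc a ^ i * b ^ j ≤ b ^ i * b ^ j := by gcongr
      _ = b ^ (i + j) := (pow_add b i j).symm
      _ ≤ a ^ (i + j) + b ^ (i + j) := le_add_of_nonneg_left (pow_nonneg ha _)
  · calc a ^ i * b ^ j ≤ a ^ i * a ^ j := by gcongr
      _ = a ^ (i + j) := (pow_add a i j).symm
      _ ≤ a ^ (i + j) + b ^ (i + j) := le_add_of_nonneg_right (pow_nonneg hb _)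

/-- The second-order Taylor polynomial of `bernoulliStd` at `p`, as a function of `d = y - p`. -/
noncomputable def bernoulliStdTaylor (p d : ℝ) : ℝ :=
  bernoulliStd p + (1 - 2 * p) / (2 * bernoulliStd p) * d + -1 / (8 * bernoulliStd p ^ 3) * d ^ 2

/-- The quadratic polynomial in `d = y - p` that approximates `betaQuantileApprox y e z - p`. -/
noncomputable def quantileQuadratic (p e z d : ℝ) : ℝ :=
  d + e * z * bernoulliStdTaylor p d + e ^ 2 * (quantileCoeffTwo p z - (2 * z ^ 2 + 1) / 3 * d) +
    e ^ 3 * quantileCoeffThree p z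

theorem continuous_bernoulliStd : Continuous bernoulliStd := by
  unfold bernoulliStd
  fun_prop

theorem differentiableAt_bernoulliStd {p : ℝ} (hp : p ∈ Set.Ioo 0 1) :
    DifferentiableAt ℝ bernoulliStd p :=
  (show DifferentiableAt ℝ (fun y : ℝ => y * (1 - y)) p by fun_prop).sqrt
    (mul_pos hp.1 (sub_pos.2 hp.2)).ne'

theorem differentiableAt_quantileCoeffThree {p : ℝ} (hp : p ∈ Set.Ioo 0 1) (z : ℝ) :
    DifferentiableAt ℝ (fun y => quantileCoeffThree y z) p := by
  have hinv := (differentiableAt_bernoulliStd hp).inv (bernoulliStd_pos hp).ne'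
  unfold quantileCoeffThree
  exact (hinv.mul (by fun_prop)).div_const 36

theorem continuous_bernoulliStdTaylor (p : ℝ) : Continuous (bernoulliStdTaylor p) := by
  unfold bernoulliStdTaylor
  fun_prop

theorem bernoulliStd_sq_sub_taylor_sq {p y : ℝ} (hp : p ∈ Set.Ioo 0 1) (hy : y ∈ Set.Icc 0 1) :
    bernoulliStd y ^ 2 - bernoulliStdTaylor p (y - p) ^ 2 =
      (y - p) ^ 3 * ((1 - 2 * p) / (8 * bernoulliStd p ^ 4) -
        (y - p) / (64 * bernoulliStd p ^ 6)) := by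
  have hσ := (bernoulliStd_pos hp).ne'
  have hσ_sq := bernoulliStd_sq (Set.Ioo_subset_Icc_self hp)
  rw [bernoulliStd_sq hy, bernoulliStdTaylor]
  set σ := bernoulliStd p
  field_simp
  linear_combination -16384 * σ ^ 4 * ((y - p) ^ 2 + σ ^ 2) * hσ_sq

theorem bernoulliStd_sub_taylor_isBigO {p : ℝ} (hp : p ∈ Set.Ioo 0 1) :
    (fun y => bernoulliStd y - bernoulliStdTaylor p (y - p)) =O[𝓝 p] fun y => (y - p) ^ 3 := by
  have hσ := bernoulliStd_pos hp
  have hsum : ContinuousAt (fun y => bernoulliStd y + bernoulliStdTaylor p (y - p)) p :=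
    (continuous_bernoulliStd.add
      ((continuous_bernoulliStdTaylor p).comp (continuous_sub_right p))).continuousAt
  have hsum_pos : 0 < bernoulliStd p + bernoulliStdTaylor p (p - p) := by
    simp only [bernoulliStdTaylor, sub_self]
    linarith
  have hquot : ContinuousAt (fun y => ((1 - 2 * p) / (8 * bernoulliStd p ^ 4) -
      (y - p) / (64 * bernoulliStd p ^ 6)) /
        (bernoulliStd y + bernoulliStdTaylor p (y - p))) p :=
    ContinuousAt.div (by fun_prop) hsum hsum_pos.ne'
  refine ((Asymptotics.isBigO_refl (fun y => (y - p) ^ 3) _).mul (hquot.isBigO_one ℝ)).congr'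
    ?_ (by simp only [mul_one, EventuallyEq.refl])
  filter_upwards [Icc_mem_nhds hp.1 hp.2, hsum.eventually_ne hsum_pos.ne'] with y hy hne
  rw [← mul_div_assoc, div_eq_iff hne, ← bernoulliStd_sq_sub_taylor_sq hp hy]
  ring

theorem betaQuantileApprox_sub_quantileQuadratic (p e z y : ℝ) :
    betaQuantileApprox y e z - p - quantileQuadratic p e z (y - p) =
      e * z * (bernoulliStd y - bernoulliStdTaylor p (y - p)) +
        e ^ 3 * (quantileCoeffThree y z - quantileCoeffThree p z) := by
  simp only [betaQuantileApprox, quantileDev, quantileQuadratic, quantileCoeffTwo]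
  ring

theorem eventually_abs_betaQuantileApprox_sub_quantileQuadratic_le {p : ℝ} (hp : p ∈ Set.Ioo 0 1)
    (z : ℝ) : ∃ C : ℝ, 0 ≤ C ∧ ∀ᶠ y in 𝓝 p, ∀ e : ℝ, 0 ≤ e →
      |betaQuantileApprox y e z - p - quantileQuadratic p e z (y - p)| ≤
        C * (e ^ 4 + (y - p) ^ 4) := by
  obtain ⟨C₁, hC₁, hstd⟩ := (bernoulliStd_sub_taylor_isBigO hp).exists_nonneg
  obtain ⟨C₃, hC₃, hthree⟩ := (differentiableAt_quantileCoeffThree hp z).isBigO_sub.exists_nonneg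
  refine ⟨|z| * C₁ + C₃, by positivity, ?_⟩
  filter_upwards [hstd.bound, hthree.bound] with y hstd hthree e he
  rw [Real.norm_eq_abs, Real.norm_eq_abs, abs_pow] at hstd
  rw [Real.norm_eq_abs, Real.norm_eq_abs] at hthree
  have hpow₁ := pow_mul_pow_le_pow_add_pow he (abs_nonneg (y - p)) 1 3
  have hpow₃ := pow_mul_pow_le_pow_add_pow he (abs_nonneg (y - p)) 3 1
  have hfour : |y - p| ^ 4 = (y - p) ^ 4 := Even.pow_abs (by decide) _
  norm_num only [pow_one, hfour] at hpow₁ hpow₃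
  rw [betaQuantileApprox_sub_quantileQuadratic]
  calc _ ≤ e * |z| * |bernoulliStd y - bernoulliStdTaylor p (y - p)| +
        e ^ 3 * |quantileCoeffThree y z - quantileCoeffThree p z| := by
        refine (abs_add_le _ _).trans_eq ?_
        rw [abs_mul, abs_mul, abs_mul, abs_of_nonneg he, abs_of_nonneg (pow_nonneg he 3)]
    _ ≤ e * |z| * (C₁ * |y - p| ^ 3) + e ^ 3 * (C₃ * |y - p|) := by gcongr
    _ = |z| * C₁ * (e * |y - p| ^ 3) + C₃ * (e ^ 3 * |y - p|) := by ring
    _ ≤ |z| * C₁ * (e ^ 4 + (y - p) ^ 4) + C₃ * (e ^ 4 + (y - p) ^ 4) := by gcongr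
    _ = (|z| * C₁ + C₃) * (e ^ 4 + (y - p) ^ 4) := by ring

theorem exists_abs_quantileQuadratic_le (p z : ℝ) :
    ∃ B : ℝ, ∀ e ∈ Set.Icc (0 : ℝ) 1, ∀ d ∈ Set.Icc (-1 : ℝ) 1,
      |quantileQuadratic p e z d| ≤ B := by
  have hcont : Continuous fun a : ℝ × ℝ => quantileQuadratic p a.1 z a.2 := by
    unfold quantileQuadratic bernoulliStdTaylor
    fun_prop
  obtain ⟨B, hB⟩ := (isCompact_Icc.prod isCompact_Icc).exists_bound_of_continuousOn
    (hcont.continuousOn (s := Set.Icc (0 : ℝ) 1 ×ˢ Set.Icc (-1 : ℝ) 1))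
  exact ⟨B, fun e he d hd => hB (e, d) ⟨he, hd⟩⟩

theorem eventually_abs_clopperPearsonUpper_sub_quantileQuadratic_le_of_near {α p : ℝ} (hα0 : 0 < α)
    (hα1 : α < 1) (hp : p ∈ Set.Ioo 0 1) :
    ∃ C : ℝ, 0 ≤ C ∧ ∃ δ : ℝ, 0 < δ ∧ ∀ᶠ n : ℕ in atTop, ∀ x : ℕ, |(x / n - p : ℝ)| < δ →
      |clopperPearsonUpper α n x - p -
        quantileQuadratic p (invSqrt n) (normalUpperQuantile α) (x / n - p)| ≤
          C * (invSqrt n ^ 4 + (x / n - p) ^ 4) := by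
  obtain ⟨η, hη, hηp⟩ : ∃ η : ℝ, 0 < η ∧ p ∈ Set.Ioo η (1 - η) := by
    obtain ⟨η, hη, hηp⟩ := exists_between (lt_min hp.1 (sub_pos.2 hp.2))
    exact ⟨η, hη, hηp.trans_le (min_le_left _ _),
      lt_sub_comm.1 (hηp.trans_le (min_le_right _ _))⟩
  obtain ⟨K, hK, hquantile⟩ := eventually_abs_clopperPearsonUpper_sub_le hα0 hα1 hη
  obtain ⟨C, hC, htaylor⟩ :=
    eventually_abs_betaQuantileApprox_sub_quantileQuadratic_le hp (normalUpperQuantile α)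
  obtain ⟨δ, hδ, hnear⟩ := Metric.eventually_nhds_iff.1
    (htaylor.and (Icc_mem_nhds hηp.1 hηp.2))
  refine ⟨K + C, by positivity, δ, hδ, ?_⟩
  filter_upwards [hquantile] with n hquantile x hx
  obtain ⟨htaylor, hbulk⟩ := hnear (y := (x / n : ℝ)) (by rwa [Real.dist_eq])
  have hd : (0 : ℝ) ≤ (x / n - p) ^ 4 := by positivity
  calc _ ≤ |clopperPearsonUpper α n x -
          betaQuantileApprox (x / n) (invSqrt n) (normalUpperQuantile α)| +
        |betaQuantileApprox (x / n) (invSqrt n) (normalUpperQuantile α) - p -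
          quantileQuadratic p (invSqrt n) (normalUpperQuantile α) (x / n - p)| := by
        refine (abs_add_le _ _).trans' (le_of_eq (congrArg _ ?_))
        ring
    _ ≤ K * invSqrt n ^ 4 + C * (invSqrt n ^ 4 + (x / n - p) ^ 4) :=
        add_le_add (hquantile x hbulk) (htaylor _ (invSqrt_nonneg n))
    _ ≤ K * (invSqrt n ^ 4 + (x / n - p) ^ 4) + C * (invSqrt n ^ 4 + (x / n - p) ^ 4) := by
        gcongr
        exact le_add_of_nonneg_right hd
    _ = (K + C) * (invSqrt n ^ 4 + (x / n - p) ^ 4) := by ring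

theorem exists_abs_clopperPearsonUpper_sub_quantileQuadratic_le {α p : ℝ} (hα0 : 0 < α)
    (hα1 : α < 1) (hp : p ∈ Set.Icc 0 1) (z : ℝ) :
    ∃ B : ℝ, ∀ n x : ℕ, x ≤ n →
      |clopperPearsonUpper α n x - p - quantileQuadratic p (invSqrt n) z (x / n - p)| ≤ B := by
  obtain ⟨B, hB⟩ := exists_abs_quantileQuadratic_le p z
  refine ⟨1 + B, fun n x hx => (abs_sub _ _).trans (add_le_add ?_ ?_)⟩
  · have hU := clopperPearsonUpper_mem_Icc hα0 hα1 hx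
    exact abs_le.2 ⟨by linarith [hU.1, hp.2], by linarith [hU.2, hp.1]⟩
  · have hy : (x / n : ℝ) ∈ Set.Icc (0 : ℝ) 1 :=
      ⟨by positivity, div_le_one_of_le₀ (Nat.cast_le.2 hx) n.cast_nonneg⟩
    exact hB _ ⟨invSqrt_nonneg n, invSqrt_le_one n⟩ _
      ⟨by linarith [hy.1, hp.2], by linarith [hy.2, hp.1]⟩

theorem eventually_abs_clopperPearsonUpper_sub_quantileQuadratic_le {α p : ℝ} (hα0 : 0 < α)
    (hα1 : α < 1) (hp : p ∈ Set.Ioo 0 1) :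
    ∃ C : ℝ, 0 ≤ C ∧ ∀ᶠ n : ℕ in atTop, ∀ x ≤ n,
      |clopperPearsonUpper α n x - p -
        quantileQuadratic p (invSqrt n) (normalUpperQuantile α) (x / n - p)| ≤
          C * (invSqrt n ^ 4 + (x / n - p) ^ 4) := by
  obtain ⟨C, hC, δ, hδ, hnear⟩ :=
    eventually_abs_clopperPearsonUpper_sub_quantileQuadratic_le_of_near hα0 hα1 hp
  obtain ⟨B, hB⟩ := exists_abs_clopperPearsonUpper_sub_quantileQuadratic_le hα0 hα1
    (Set.Ioo_subset_Icc_self hp) (normalUpperQuantile α)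
  have hB₀ : 0 ≤ B := (abs_nonneg _).trans (hB 0 0 le_rfl)
  refine ⟨C + B / δ ^ 4, by positivity, ?_⟩
  filter_upwards [hnear] with n hnear x hx
  rw [add_mul]
  have he : 0 ≤ invSqrt n ^ 4 := pow_nonneg (invSqrt_nonneg n) 4
  obtain hd | hd := lt_or_ge |(x / n - p : ℝ)| δ
  · exact (hnear x hd).trans (le_add_of_nonneg_right (by positivity))
  · have hfour : δ ^ 4 ≤ (x / n - p : ℝ) ^ 4 := by
      rw [← Even.pow_abs (by decide : Even 4) (x / n - p : ℝ)]
      gcongr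
    calc _ ≤ B := hB n x hx
      _ = B / δ ^ 4 * δ ^ 4 := by field_simp
      _ ≤ B / δ ^ 4 * (invSqrt n ^ 4 + (x / n - p) ^ 4) := by
        gcongr
        exact hfour.trans (le_add_of_nonneg_left he)
      _ ≤ _ := le_add_of_nonneg_left (by positivity)

/-! ### The mean of the quadratic approximation -/

theorem binomialMean_frequency_sub_pow_four_le {n : ℕ} {p : ℝ} (hn : n ≠ 0)
    (hp : p ∈ Set.Icc 0 1) :
    binomialMean n p (fun k => ((k : ℝ) / n - p) ^ 4) ≤ invSqrt n ^ 4 := by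
  have hn₀ : (n : ℝ) ≠ 0 := Nat.cast_ne_zero.2 hn
  have hcentered : (fun k : ℕ => ((k : ℝ) / n - p) ^ 4) =
      fun k : ℕ => invSqrt n ^ 8 * ((k : ℝ) - n * p) ^ 4 := by
    funext k
    rw [show (k : ℝ) / n - p = (k - n * p) * (n : ℝ)⁻¹ by field_simp, ← invSqrt_sq]
    ring
  rw [hcentered, binomialMean_const_mul]
  calc invSqrt n ^ 8 * _ ≤ invSqrt n ^ 8 * (n : ℝ) ^ 2 := by
        gcongr
        exact binomialMean_centered_pow_four_le n hp
    _ = invSqrt n ^ 4 * (n * invSqrt n ^ 2) ^ 2 := by ring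
    _ = invSqrt n ^ 4 := by rw [natCast_mul_invSqrt_sq hn, one_pow, mul_one]

theorem binomialMean_quantileQuadratic {n : ℕ} {p : ℝ} (hn : n ≠ 0) (hp : p ∈ Set.Ioo 0 1)
    (z : ℝ) :
    binomialMean n p (fun k => quantileQuadratic p (invSqrt n) z (k / n - p)) =
      invSqrt n * z * bernoulliStd p + invSqrt n ^ 2 * quantileCoeffTwo p z +
        invSqrt n ^ 3 * (quantileCoeffThree p z - z / (8 * bernoulliStd p)) := by
  have hn₀ : (n : ℝ) ≠ 0 := Nat.cast_ne_zero.2 hn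
  have hσ := (bernoulliStd_pos hp).ne'
  have hσ_sq := bernoulliStd_sq (Set.Ioo_subset_Icc_self hp)
  have he := invSqrt_sq n
  have hcentered : (fun k : ℕ => quantileQuadratic p (invSqrt n) z (k / n - p)) = fun k : ℕ =>
      quantileQuadratic p (invSqrt n) z 0 +
      ((1 + invSqrt n * z * ((1 - 2 * p) / (2 * bernoulliStd p)) -
        invSqrt n ^ 2 * ((2 * z ^ 2 + 1) / 3)) / n * ((k : ℝ) - n * p) +
      invSqrt n * z * (-1 / (8 * bernoulliStd p ^ 3)) / n ^ 2 * ((k : ℝ) - n * p) ^ 2) := by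
    funext k
    rw [show (k : ℝ) / n - p = (k - n * p) / n by field_simp]
    simp only [quantileQuadratic, bernoulliStdTaylor]
    ring
  rw [hcentered, binomialMean_add, binomialMean_const, binomialMean_add, binomialMean_const_mul,
    binomialMean_const_mul, binomialMean_centered, binomialMean_centered_sq, ← hσ_sq]
  have hquad : invSqrt n * z * (-1 / (8 * bernoulliStd p ^ 3)) / (n : ℝ) ^ 2 *
      (n * bernoulliStd p ^ 2) = -(invSqrt n * z / (8 * bernoulliStd p) * (n : ℝ)⁻¹) := by
    field_simp
  rw [hquad, ← he]
  simp only [quantileQuadratic, bernoulliStdTaylor]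
  ring

theorem quantileCoeffThree_sub_div_eq {p : ℝ} (hp : p ∈ Set.Ioo 0 1) (z : ℝ) :
    quantileCoeffThree p z - z / (8 * bernoulliStd p) =
      z * bernoulliStd p * (-(53 / 36) + (1 / 2 - p) / (1 - p) +
        (z ^ 2 + 13 / 2) / (36 * p * (1 - p)) - 13 * z ^ 2 / 36) := by
  have hσ := (bernoulliStd_pos hp).ne'
  have hσ_sq := bernoulliStd_sq (Set.Ioo_subset_Icc_self hp)
  have hp₀ : p ≠ 0 := hp.1.ne'
  have hq₀ : 1 - p ≠ 0 := (sub_pos.2 hp.2).ne'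
  have hscaled : bernoulliStd p * (quantileCoeffThree p z - z / (8 * bernoulliStd p)) =
      p * (1 - p) * (z * (-(53 / 36) + (1 / 2 - p) / (1 - p) +
        (z ^ 2 + 13 / 2) / (36 * p * (1 - p)) - 13 * z ^ 2 / 36)) := by
    rw [quantileCoeffThree]
    field_simp
    ring
  rw [← hσ_sq] at hscaled
  refine mul_left_cancel₀ hσ (hscaled.trans ?_)
  ring

theorem eventually_abs_binomialMean_clopperPearsonUpper_sub_le {α p : ℝ} (hα0 : 0 < α)
    (hα1 : α < 1) (hp : p ∈ Set.Ioo 0 1) :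
    ∃ C : ℝ, ∀ᶠ n : ℕ in atTop,
      |binomialMean n p (fun k => clopperPearsonUpper α n k - p) -
        binomialMean n p (fun k =>
          quantileQuadratic p (invSqrt n) (normalUpperQuantile α) (k / n - p))| ≤
        C * invSqrt n ^ 4 := by
  obtain ⟨C, hC, herror⟩ :=
    eventually_abs_clopperPearsonUpper_sub_quantileQuadratic_le hα0 hα1 hp
  have hp' := Set.Ioo_subset_Icc_self hp
  refine ⟨C * 2, ?_⟩
  filter_upwards [herror, eventually_ne_atTop 0] with n herror hn
  rw [← binomialMean_sub]
  refine (abs_binomialMean_le hp' herror).trans ?_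
  rw [binomialMean_const_mul, binomialMean_add, binomialMean_const, mul_assoc, two_mul]
  gcongr
  exact binomialMean_frequency_sub_pow_four_le hn hp'

theorem theorem3 (α p : ℝ) (hα0 : 0 < α) (hα1 : α < 1) (hp0 : 0 < p) (hp1 : p < 1)
    (q z : ℝ) (hq : q = 1 - p) (hz : z = normalUpperQuantile α) :
    (fun n : ℕ =>
      (∫ x, (clopperPearsonUpper α n x - p) ∂(ProbabilityTheory.binomial n ⟨p, hp0.le, hp1.le⟩)) -
        ((n : ℝ) ^ (-(1 / 2) : ℝ) * z * √(p * q)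
          + (3 * (n : ℝ))⁻¹ * (2 * (1 / 2 - p) * z ^ 2 + 1 + q)
          + (n : ℝ) ^ (-(3 / 2) : ℝ) * z * √(p * q) *
              (-(53 / 36) + (1 / 2 - p) / q + (z ^ 2 + 13 / 2) / (36 * p * q)
                - 13 * z ^ 2 / 36)))
      =O[Filter.atTop] fun n : ℕ => (n : ℝ) ^ (-2 : ℝ) := by
  obtain ⟨C, hC⟩ := eventually_abs_binomialMean_clopperPearsonUpper_sub_le hα0 hα1 ⟨hp0, hp1⟩
  refine Asymptotics.IsBigO.of_bound C ?_
  filter_upwards [hC, eventually_ne_atTop 0] with n hC hn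
  rw [← hz, binomialMean_quantileQuadratic hn ⟨hp0, hp1⟩,
    quantileCoeffThree_sub_div_eq ⟨hp0, hp1⟩] at hC
  have he : 0 ≤ invSqrt n ^ 4 := pow_nonneg (invSqrt_nonneg n) 4
  rw [natCast_rpow_neg_two, Real.norm_eq_abs, Real.norm_eq_abs, abs_of_nonneg he,
    integral_binomial_eq_binomialMean n ⟨hp0.le, hp1.le⟩, natCast_rpow_neg_half,
    natCast_rpow_neg_three_halves, hq]
  refine hC.trans_eq' (congrArg (fun t => |_ - t|) ?_)
  rw [mul_inv, ← invSqrt_sq, ← bernoulliStd, quantileCoeffTwo]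
  ring
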